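/- Let $X$ be a finite alphabet with $|X|\ge 2$ and let $G$ be a self-similar group over $X$, that is, a group acting faithfully by length-preserving permutations on the set $X^*$ of words over $X$ such that for all $g\in G$, $x\in X$ there is an element $g|_x\in G$ (the section of $g$ at $x$) with $g(xw)=g(x)\,g|_x(w)$ for all $w\in X^*$; put $g|_{\varepsilon}=g$ and $g|_{xv}=(g|_x)|_v$. A finite automaton in $G$ is a finite subset of $G$ closed under taking sections. Suppose that $G$ is contracting: there is a finite automaton $N\subseteq G$ such that for every $g\in G$ there is $n\ge 0$ with $g|_w\in N$ for all words $w$ of length $n$; the smallest such $N$ is the nucleus of $G$. Let $S$ be the associated inverse semigroup, i.e. the inverse hull of the left cancellative monoid $M=X^*G$ with product $ug\cdot vh=u\,g(v)\,g|_v\,h$ ($u,v\in X^*$, $g,h\in G$), consisting of the empty map and the partial bijections $ugv^*\colon vm\mapsto ugm$ of $M$. The groupoid associated to $G$ is the tight groupoid $\mathcal G_T(S)$, i.e. the groupoid of germs of the action of $S$ on the space of tight filters of its idempotent semilattice. Let $A\subseteq G$ be a finite automaton containing the nucleus of $G$. Define equivalence relations $\equiv_w$ on $A$ ($w\in X^*$)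 recursively: $\equiv_\varepsilon$ is equality, and for $x\in X$, $g\equiv_{xw}h$ if and only if $g(x)=h(x)$ and $g|_x\equiv_w h|_x$. Let $\Sigma_A$ be the finite digraph with vertex set $V=\{\equiv_w : w\in X^*\}$ and, for each $x\in X$, an edge labelled $x$ from each vertex $\equiv$ to the vertex $x\cdot{\equiv}$, where $g\mathrel{(x\cdot{\equiv})}h$ if and only if $g(x)=h(x)$ and $g|_x\equiv h|_x$. For $u\in X^*$ let $V_u=\{\equiv_{uw} : w\in X^*\}$. Let $V_{\min}$ be the set of vertices of $\Sigma_A$ lying in minimal strongly connected components (those that no edge leaves), and let $V_{\mathrm{ess}}$ be the set of essential vertices, i.e. those reachable from a directed cycle. Then $\mathcal G_T(S)$ is Hausdorff if and only if there exists $n\ge 0$ such that $|V_w|=1$ for all $w\in X^*$ of length $n$. In particular, if $\mathcal G_T(S)$ is Hausdorff, then $V_{\min}=V_{\mathrm{ess}}$. -/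

import Mathlib

/-! ### Inverse semigroups with zero -/

/-- An inverse semigroup with zero: every `s` has a unique element `star s` with
`s * star s * s = s` and `star s * s * star s = star s`. -/
class InverseSemigroupWithZero (S : Type*) extends SemigroupWithZero S, Star S where
  mul_star_mul : ∀ s : S, s * star s * s = s
  star_self_star : ∀ s : S, star s * s * star s = star s
  star_unique : ∀ s t : S, s * t * s = s → t * s * t = t → t = star s

namespace InverseSemigroupWithZero

variable {S : Type*} [InverseSemigroupWithZero S]

theorem star_idem {e : S} (he : IsIdempotentElem e) : star e = e := by
  have h : e * e = e := he
  exact (star_unique e e (by rw [h, h]) (by rw [h, h])).symm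

theorem star_star_self (s : S) : star (star s) = s :=
  (star_unique (star s) s (star_self_star s) (mul_star_mul s)).symm

theorem idem_mul {e f : S} (he : IsIdempotentElem e) (hf : IsIdempotentElem f) :
    IsIdempotentElem (e * f) := by
  have h1 : e * e = e := he
  have h2 : f * f = f := hf
  set x := star (e * f) with hx
  have a : e * f * x * (e * f) = e * f := mul_star_mul (e * f)
  have b : x * (e * f) * x = x := star_self_star (e * f)
  have key : f * x * e = x := by
    apply star_unique
    · calc e * f * (f * x * e) * (e * f) = e * (f * f) * x * (e * e) * f := by
            simp only [mul_assoc]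
        _ = e * f * x * (e * f) := by rw [h1, h2]; simp only [mul_assoc]
        _ = e * f := a
    · calc f * x * e * (e * f) * (f * x * e) = f * (x * ((e * e) * (f * f)) * x) * e := by
            simp only [mul_assoc]
        _ = f * x * e := by rw [h1, h2, b]
  have hxi : x * x = x := by
    calc x * x = (f * x * e) * (f * x * e) := by rw [key]
      _ = f * (x * (e * f) * x) * e := by simp only [mul_assoc]
      _ = x := by rw [b, key]
  have h3 : star x = x := star_idem hxi
  have h4 : star x = e * f := star_star_self (e * f)
  rw [← h4, h3]; exact hxi

theorem idem_comm {e f : S} (he : IsIdempotentElem e) (hf : IsIdempotentElem f) :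
    e * f = f * e := by
  have h1 : e * e = e := he
  have h2 : f * f = f := hf
  have hef : e * f * (e * f) = e * f := idem_mul he hf
  have hfe : f * e * (f * e) = f * e := idem_mul hf he
  have h3 : f * e = star (e * f) := by
    apply star_unique
    · calc e * f * (f * e) * (e * f) = e * (f * f) * (e * e) * f := by simp only [mul_assoc]
        _ = e * f := by rw [h1, h2, mul_assoc, hef]
    · calc f * e * (e * f) * (f * e) = f * (e * e) * (f * f) * e := by simp only [mul_assoc]
        _ = f * e := by rw [h1, h2, mul_assoc, hfe]
  rw [h3, star_idem (idem_mul he hf)]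

theorem idem_star_mul (s : S) : IsIdempotentElem (star s * s) := by
  change star s * s * (star s * s) = _
  rw [← mul_assoc, star_self_star]

theorem idem_mul_star (s : S) : IsIdempotentElem (s * star s) := by
  change s * star s * (s * star s) = _
  rw [← mul_assoc, mul_star_mul]

/-- `e s = s (star s e s)` for idempotents `e`. -/
theorem idem_mul_eq {e : S} (he : IsIdempotentElem e) (s : S) :
    s * (star s * e * s) = e * s := by
  calc s * (star s * e * s) = (s * star s) * e * s := by simp only [mul_assoc]
    _ = e * (s * star s) * s := by rw [idem_comm (idem_mul_star s) he]
    _ = e * s := by rw [mul_assoc, mul_star_mul]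

theorem star_mul_idem {e : S} (he : IsIdempotentElem e) (s : S) :
    star s * e * (s * star s) = star s * e := by
  rw [mul_assoc, idem_comm he (idem_mul_star s), ← mul_assoc, ← mul_assoc, star_self_star]

theorem conj_mul_conj {e : S} (he : IsIdempotentElem e) (f s : S) :
    (star s * e * s) * (star s * f * s) = star s * (e * f) * s := by
  calc (star s * e * s) * (star s * f * s) = star s * e * (s * star s) * f * s := by
        simp only [mul_assoc]
    _ = star s * (e * f) * s := by rw [star_mul_idem he]; simp only [mul_assoc]

theorem idem_conj {e : S} (he : IsIdempotentElem e) (s : S) :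
    IsIdempotentElem (star s * e * s) := by
  have h : e * e = e := he
  change _ * _ = _
  rw [conj_mul_conj he, h]

theorem star_mul_rev (s t : S) : star (s * t) = star t * star s := by
  have h := idem_comm (idem_star_mul s) (idem_mul_star t)
  refine (star_unique _ _ ?_ ?_).symm
  · calc s * t * (star t * star s) * (s * t) = s * ((t * star t) * (star s * s)) * t := by
          simp only [mul_assoc]
      _ = (s * star s * s) * (t * star t * t) := by rw [← h]; simp only [mul_assoc]
      _ = s * t := by rw [mul_star_mul, mul_star_mul]
  · calc star t * star s * (s * t) * (star t * star s)
        = star t * ((star s * s) * (t * star t)) * star s := by simp only [mul_assoc]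
      _ = (star t * t * star t) * (star s * s * star s) := by rw [h]; simp only [mul_assoc]
      _ = star t * star s := by rw [star_self_star, star_self_star]

end InverseSemigroupWithZero

/-! ### The tight groupoid of an inverse semigroup with zero -/

section TightGroupoid

open InverseSemigroupWithZero

/-- The finite set `C` of idempotents covers the idempotent `e`: every member of `C` lies below
`e`, and every nonzero idempotent below `e` meets some member of `C`.
(Recall `f ≤ e` means `f * e = f`.) -/
def Covers {S : Type*} [InverseSemigroupWithZero S] (C : Finset S) (e : S) : Prop :=
  (∀ c ∈ C, IsIdempotentElem c ∧ c * e = c) ∧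
    ∀ f : S, IsIdempotentElem f → f ≠ 0 → f * e = f → ∃ c ∈ C, f * c ≠ 0

/-- A tight filter: a proper filter of the semilattice of idempotents which, with each element `e`,
contains a member of every finite cover of `e`. -/
@[ext]
structure TightFilter (S : Type*) [InverseSemigroupWithZero S] where
  carrier : Set S
  idem : ∀ e ∈ carrier, IsIdempotentElem e
  nonempty : carrier.Nonempty
  zero_notMem : (0 : S) ∉ carrier
  mul_mem : ∀ e ∈ carrier, ∀ f ∈ carrier, e * f ∈ carrier
  mem_of_le : ∀ e ∈ carrier, ∀ f, IsIdempotentElem f → e * f = e → f ∈ carrier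
  tight : ∀ e ∈ carrier, ∀ C : Finset S, Covers C e → ∃ c ∈ C, c ∈ carrier

namespace TightFilter

variable {S : Type*} [InverseSemigroupWithZero S]

instance : Membership S (TightFilter S) := ⟨fun F e => e ∈ F.carrier⟩

/-- The topology of pointwise convergence of characters: it is generated by the sets
`{F | e ∈ F}` and their complements. -/
instance : TopologicalSpace (TightFilter S) :=
  TopologicalSpace.generateFrom
    {U | ∃ e : S, IsIdempotentElem e ∧ (U = {F | e ∈ F} ∨ U = {F | e ∉ F})}

/-- The partial action of `S` on tight filters: `s` takes a filter `F` containing `star s * s`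
to the filter of all idempotents `f` with `star s * f * s ∈ F`. -/
def act (s : S) (F : TightFilter S) (h : star s * s ∈ F) : TightFilter S where
  carrier := {f | IsIdempotentElem f ∧ star s * f * s ∈ F}
  idem := fun _ hf => hf.1
  nonempty := ⟨s * star s, idem_mul_star s, by
    have : star s * (s * star s) * s = star s * s := by
      rw [← mul_assoc (star s), star_self_star]
    rw [this]; exact h⟩
  zero_notMem := by
    rintro ⟨-, h0⟩
    rw [mul_zero, zero_mul] at h0
    exact F.zero_notMem h0
  mul_mem := by
    rintro e ⟨he, hes⟩ f ⟨hf, hfs⟩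
    refine ⟨idem_mul he hf, ?_⟩
    rw [← conj_mul_conj he]
    exact F.mul_mem _ hes _ hfs
  mem_of_le := by
    rintro e ⟨he, hes⟩ f hf hef
    refine ⟨hf, F.mem_of_le _ hes _ (idem_conj hf s) ?_⟩
    rw [conj_mul_conj he, hef]
  tight := by
    classical
    rintro e ⟨he, hes⟩ C ⟨hC1, hC2⟩
    obtain ⟨c', hc', hc'F⟩ := F.tight _ hes (C.image fun c => star s * c * s) (by
      refine ⟨?_, ?_⟩
      · intro c' hc'
        obtain ⟨c, hc, rfl⟩ := Finset.mem_image.1 hc'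
        refine ⟨idem_conj (hC1 c hc).1 s, ?_⟩
        rw [conj_mul_conj (hC1 c hc).1, (hC1 c hc).2]
      · intro g hg hg0 hge
        have hgs : g * (star s * s) = g := by
          calc g * (star s * s) = g * (star s * e * s) * (star s * s) := by rw [hge]
            _ = g * (star s * e * (s * star s) * s) := by simp only [mul_assoc]
            _ = g := by rw [star_mul_idem he, hge]
        have hsg : (star s * s) * g = g := by rw [idem_comm (idem_star_mul s) hg, hgs]
        have hgi : IsIdempotentElem (s * g * star s) := by
          have := idem_conj hg (star s)
          rwa [star_star_self] at this
        obtain ⟨c, hc, hne⟩ := hC2 (s * g * star s) hgi (by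
          intro h0
          apply hg0
          calc g = (star s * s) * g * (star s * s) := by rw [hsg, hgs]
            _ = star s * (s * g * star s) * s := by simp only [mul_assoc]
            _ = 0 := by rw [h0, mul_zero, zero_mul]) (by
          calc s * g * star s * e = s * g * (star s * e) := by simp only [mul_assoc]
            _ = s * (g * (star s * e * s)) * star s := by
                conv_lhs => rw [← star_mul_idem he]
                simp only [mul_assoc]
            _ = s * g * star s := by rw [hge])
        refine ⟨_, Finset.mem_image_of_mem _ hc, fun h0 => hne ?_⟩
        calc s * g * star s * c = s * g * (star s * c) := by simp only [mul_assoc]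
          _ = s * (g * (star s * c * s)) * star s := by
              conv_lhs => rw [← star_mul_idem (hC1 c hc).1]
              simp only [mul_assoc]
          _ = 0 := by rw [h0, mul_zero, zero_mul])
    obtain ⟨c, hc, rfl⟩ := Finset.mem_image.1 hc'
    exact ⟨c, hc, (hC1 c hc).1, hc'F⟩

end TightFilter

/-- Pairs `(s, F)` with `F` in the domain of the action of `s`. -/
structure PreGerm (S : Type*) [InverseSemigroupWithZero S] where
  elt : S
  filter : TightFilter S
  dom : star elt * elt ∈ filter

/-- `(s, F)` and `(t, F')` have the same germ iff `F = F'` and `s e = t e` for some `e ∈ F`. -/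
instance PreGerm.setoid (S : Type*) [InverseSemigroupWithZero S] : Setoid (PreGerm S) where
  r p q := p.filter = q.filter ∧ ∃ e ∈ p.filter, p.elt * e = q.elt * e
  iseqv :=
    { refl := fun p => ⟨rfl, _, p.dom, rfl⟩
      symm := by
        rintro p q ⟨h, e, he, hpq⟩
        exact ⟨h.symm, e, h ▸ he, hpq.symm⟩
      trans := by
        rintro p q r ⟨h, e, he, hpq⟩ ⟨h', f, hf, hqr⟩
        have hf' : f ∈ p.filter := by rw [h]; exact hf
        refine ⟨h.trans h', e * f, p.filter.mul_mem _ he _ hf', ?_⟩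
        calc p.elt * (e * f) = p.elt * e * f := by rw [mul_assoc]
          _ = q.elt * (e * f) := by rw [hpq, mul_assoc]
          _ = q.elt * (f * e) := by
              rw [idem_comm (p.filter.idem _ he) (p.filter.idem _ hf')]
          _ = r.elt * (f * e) := by rw [← mul_assoc, hqr, mul_assoc]
          _ = r.elt * (e * f) := by
              rw [idem_comm (p.filter.idem _ he) (p.filter.idem _ hf')] }

/-- The tight groupoid of `S` (its space of arrows): all germs `[s, F]` of the action of `S` on
the space of tight filters. -/
def TightGroupoid (S : Type*) [InverseSemigroupWithZero S] : Type _ :=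
  Quotient (PreGerm.setoid S)

namespace TightGroupoid

variable {S : Type*} [InverseSemigroupWithZero S]

/-- The germ `[s, F]`. -/
def germ (s : S) (F : TightFilter S) (h : star s * s ∈ F) : TightGroupoid S :=
  Quotient.mk _ ⟨s, F, h⟩

/-- The topology of the tight groupoid, generated by the sets
`Θ(s, U) = {[s, F] | F ∈ U, star s * s ∈ F}` for `s ∈ S` and `U` an open set of tight filters. -/
instance : TopologicalSpace (TightGroupoid S) :=
  TopologicalSpace.generateFrom
    {Θ | ∃ (s : S) (U : Set (TightFilter S)), IsOpen U ∧
      Θ = {γ | ∃ (F : TightFilter S) (h : star s * s ∈ F), F ∈ U ∧ γ = germ s F h}}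

/-- The source of `[s, F]` is `F`. -/
def source : TightGroupoid S → TightFilter S :=
  Quotient.lift (fun p => p.filter) fun _ _ h => h.1

theorem act_mono {s t : S} {F : TightFilter S} (hs : star s * s ∈ F) (ht : star t * t ∈ F)
    {e : S} (he : e ∈ F) (hst : s * e = t * e) {f : S} (hf : f ∈ F.act s hs) :
    f ∈ F.act t ht := by
  obtain ⟨hfi, hfF⟩ := hf
  refine ⟨hfi, F.mem_of_le _ (F.mul_mem _ (F.mul_mem _ he _ hfF) _ he) _ (idem_conj hfi t) ?_⟩
  have hei := F.idem e he
  have hee : e * e = e := hei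
  have key : e * (star s * f * s) * e = e * (star t * f * t) * e := by
    calc e * (star s * f * s) * e = star (s * e) * f * (s * e) := by
          rw [star_mul_rev, star_idem hei]; simp only [mul_assoc]
      _ = star (t * e) * f * (t * e) := by rw [hst]
      _ = e * (star t * f * t) * e := by
          rw [star_mul_rev, star_idem hei]; simp only [mul_assoc]
  rw [key]
  have hc := idem_conj hfi t
  have hcc : (star t * f * t) * (star t * f * t) = star t * f * t := hc
  generalize star t * f * t = c at hc hcc
  calc e * c * e * c = e * c * (e * c) := by rw [mul_assoc (e * c)]
    _ = e * c * (c * e) := by rw [idem_comm hei hc]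
    _ = e * (c * c) * e := by simp only [mul_assoc]
    _ = e * c * e := by rw [hcc]

/-- The range of `[s, F]` is the image of `F` under `s`. -/
def range : TightGroupoid S → TightFilter S :=
  Quotient.lift (fun p => p.filter.act p.elt p.dom) (by
    rintro ⟨s, F, hs⟩ ⟨t, F', ht⟩ ⟨h, e, he, hst⟩
    obtain rfl : F = F' := h
    exact TightFilter.ext (Set.ext fun f =>
      ⟨fun hf => act_mono hs ht he hst hf, fun hf => act_mono ht hs he hst.symm hf⟩))

theorem range_germ (s : S) (F : TightFilter S) (h : star s * s ∈ F) :
    range (germ s F h) = F.act s h := rfl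

theorem germ_eq {s t : S} {F : TightFilter S} {hs : star s * s ∈ F} {ht : star t * t ∈ F}
    (e : S) (he : e ∈ F) (h : s * e = t * e) : germ s F hs = germ t F ht :=
  Quotient.sound ⟨rfl, e, he, h⟩

theorem comp_dom {s t : S} {F : TightFilter S} {hs : star s * s ∈ F}
    (ht : star t * t ∈ F.act s hs) : star (t * s) * (t * s) ∈ F := by
  have h := ht.2
  rw [star_mul_rev]
  simpa only [mul_assoc] using h

theorem act_act {s t : S} {F : TightFilter S} {hs : star s * s ∈ F}
    (ht : star t * t ∈ F.act s hs) : (F.act s hs).act t ht = F.act (t * s) (comp_dom ht) := by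
  refine TightFilter.ext (Set.ext fun f => ?_)
  have h : star (t * s) * f * (t * s) = star s * (star t * f * t) * s := by
    rw [star_mul_rev]; simp only [mul_assoc]
  constructor
  · rintro ⟨hf, hf'⟩
    exact ⟨hf, by rw [h]; exact hf'.2⟩
  · rintro ⟨hf, hf'⟩
    exact ⟨hf, idem_conj hf t, by rw [← h]; exact hf'⟩

theorem inv_dom {s : S} {F : TightFilter S} (hs : star s * s ∈ F) :
    star (star s) * star s ∈ F.act s hs := by
  rw [star_star_self]
  refine ⟨idem_mul_star s, ?_⟩
  rwa [← mul_assoc (star s), star_self_star]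

theorem act_congr {s t : S} {F : TightFilter S} {hs : star s * s ∈ F} {ht : star t * t ∈ F}
    (h : germ s F hs = germ t F ht) : F.act s hs = F.act t ht := by
  rw [← range_germ, h, range_germ]

theorem germ_congr {s t : S} {F F' : TightFilter S} {hs : star s * s ∈ F} {ht : star t * t ∈ F'}
    (hF : F = F') (h : s = t) : germ s F hs = germ t F' ht := by
  subst hF; subst h; rfl

theorem exists_of_germ_eq {s t : S} {F : TightFilter S} {hs : star s * s ∈ F}
    {ht : star t * t ∈ F} (h : germ s F hs = germ t F ht) : ∃ e ∈ F, s * e = t * e :=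
  (Quotient.exact h).2

/-- The arrows from `F` to `F'`: the germs with source `F` and range `F'`. -/
def Arrow (F F' : TightFilter S) : Type _ :=
  {γ : TightGroupoid S // source γ = F ∧ range γ = F'}

/-- The germ `[s, F]` as an arrow from `F` to `F' = s F`. -/
def Arrow.mk (s : S) (F F' : TightFilter S) (hs : star s * s ∈ F) (h : F.act s hs = F') :
    Arrow F F' :=
  ⟨germ s F hs, rfl, h⟩

theorem Arrow.exists_rep {F F' : TightFilter S} (γ : Arrow F F') :
    ∃ (s : S) (hs : star s * s ∈ F) (h : F.act s hs = F'), γ = Arrow.mk s F F' hs h := by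
  obtain ⟨γ, h1, h2⟩ := γ
  induction γ using Quotient.inductionOn with
  | h p =>
    obtain ⟨s, F₀, hs⟩ := p
    obtain rfl : F₀ = F := h1
    exact ⟨s, hs, h2, rfl⟩

theorem comp_congr {s s' t t' : S} {F F' : TightFilter S} {hs : star s * s ∈ F}
    {hs' : star s' * s' ∈ F} {ht : star t * t ∈ F'} {ht' : star t' * t' ∈ F'}
    (hF : F.act s hs = F') (h1 : germ s F hs = germ s' F hs')
    (h2 : germ t F' ht = germ t' F' ht') {h : star (t * s) * (t * s) ∈ F}
    {h' : star (t' * s') * (t' * s') ∈ F} :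
    germ (t * s) F h = germ (t' * s') F h' := by
  subst hF
  obtain ⟨e, he, hse⟩ := exists_of_germ_eq h1
  obtain ⟨f, hf, htf⟩ := exists_of_germ_eq h2
  obtain ⟨hfi, hf⟩ := hf
  refine germ_eq (star s * f * s * e) (F.mul_mem _ hf _ he) ?_
  calc t * s * (star s * f * s * e) = t * (s * (star s * f * s)) * e := by
        simp only [mul_assoc]
    _ = (t * f) * (s * e) := by rw [idem_mul_eq hfi]; simp only [mul_assoc]
    _ = (t' * f) * (s' * e) := by rw [htf, hse]
    _ = t' * (f * (s' * e)) := by simp only [mul_assoc]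
    _ = t' * (f * (s * e)) := by rw [hse]
    _ = t' * (s * (star s * f * s)) * e := by rw [idem_mul_eq hfi]; simp only [mul_assoc]
    _ = t' * (s * (star s * f * s) * e) := by simp only [mul_assoc]
    _ = t' * (s * (e * (star s * f * s))) := by
        rw [idem_comm (F.idem e he) (idem_conj hfi s)]; simp only [mul_assoc]
    _ = t' * (s' * (e * (star s * f * s))) := by rw [← mul_assoc s, hse, mul_assoc]
    _ = t' * s' * (star s * f * s * e) := by
        rw [idem_comm (F.idem e he) (idem_conj hfi s)]; simp only [mul_assoc]

theorem inv_congr {s s' : S} {F F' : TightFilter S} {hs : star s * s ∈ F}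
    {hs' : star s' * s' ∈ F} (hF : F.act s hs = F') (h1 : germ s F hs = germ s' F hs')
    {h : star (star s) * star s ∈ F'} {h' : star (star s') * star s' ∈ F'} :
    germ (star s) F' h = germ (star s') F' h' := by
  subst hF
  obtain ⟨e, he, hse⟩ := exists_of_germ_eq h1
  have hei := F.idem e he
  have hc := idem_conj hei (star s)
  rw [star_star_self] at hc
  have key : ∀ r : S, star r * (r * e * star r) = e * star r := by
    intro r
    have := idem_mul_eq hei (star r)
    rwa [star_star_self] at this
  have h2 : e * star s = e * star s' := by
    have := congrArg star hse
    rwa [star_mul_rev, star_mul_rev, star_idem hei] at this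
  have h3 : s * e * star s = s' * e * star s' := by
    rw [mul_assoc, h2, ← mul_assoc, hse]
  refine germ_eq (s * e * star s) ⟨hc, ?_⟩ ?_
  · have : star s * (s * e * star s) * s = (star s * s) * e * (star s * s) := by
      simp only [mul_assoc]
    rw [this]
    exact F.mul_mem _ (F.mul_mem _ hs _ he) _ hs
  · rw [key, h3, key, h2]

theorem unit_dom {e : S} {F : TightFilter S} (he : e ∈ F) : star e * e ∈ F := by
  rw [star_idem (F.idem e he), show e * e = e from F.idem e he]; exact he

theorem act_unit {e : S} {F : TightFilter S} (he : e ∈ F) : F.act e (unit_dom he) = F := by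
  have hei := F.idem e he
  refine TightFilter.ext (Set.ext fun f => ⟨?_, fun hf => ?_⟩)
  · rintro ⟨hfi, hf⟩
    refine F.mem_of_le _ hf f hfi ?_
    have h2 : f * f = f := hfi
    rw [star_idem hei]
    calc e * f * e * f = e * f * (e * f) := by rw [mul_assoc (e * f)]
      _ = e * f * (f * e) := by rw [idem_comm hei hfi]
      _ = e * (f * f) * e := by simp only [mul_assoc]
      _ = e * f * e := by rw [h2]
  · refine ⟨F.idem f hf, ?_⟩
    rw [star_idem hei]
    exact F.mul_mem _ (F.mul_mem _ he _ hf) _ he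

theorem comp_dom' {s t : S} {F F' : TightFilter S} {hs : star s * s ∈ F}
    (hF : F.act s hs = F') (ht : star t * t ∈ F') : star (t * s) * (t * s) ∈ F := by
  subst hF; exact comp_dom ht

theorem comp_act {s t : S} {F F' F'' : TightFilter S} {hs : star s * s ∈ F}
    (hF : F.act s hs = F') {ht : star t * t ∈ F'} (hF' : F'.act t ht = F'') :
    F.act (t * s) (comp_dom' hF ht) = F'' := by
  subst hF; rw [← hF', act_act]

theorem inv_dom' {s : S} {F F' : TightFilter S} {hs : star s * s ∈ F} (hF : F.act s hs = F') :
    star (star s) * star s ∈ F' := by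
  subst hF; exact inv_dom hs

theorem inv_act {s : S} {F F' : TightFilter S} {hs : star s * s ∈ F} (hF : F.act s hs = F') :
    F'.act (star s) (inv_dom' hF) = F := by
  subst hF; rw [act_act, act_unit hs]

/-- The unit at `F` is the germ `[e, F]` for any `e ∈ F`. -/
noncomputable def Arrow.id (F : TightFilter S) : Arrow F F :=
  Arrow.mk F.nonempty.some F F (unit_dom F.nonempty.some_mem) (act_unit F.nonempty.some_mem)

/-- The composite of `[s, F]` followed by `[t, s F]` is `[t * s, F]`. -/
noncomputable def Arrow.comp {F F' F'' : TightFilter S} (γ : Arrow F F') (δ : Arrow F' F'') :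
    Arrow F F'' :=
  Arrow.mk (δ.exists_rep.choose * γ.exists_rep.choose) F F''
    (comp_dom' γ.exists_rep.choose_spec.choose_spec.choose δ.exists_rep.choose_spec.choose)
    (comp_act γ.exists_rep.choose_spec.choose_spec.choose
      δ.exists_rep.choose_spec.choose_spec.choose)

/-- The inverse of `[s, F]` is `[star s, s F]`. -/
noncomputable def Arrow.inv {F F' : TightFilter S} (γ : Arrow F F') : Arrow F' F :=
  Arrow.mk (star γ.exists_rep.choose) F' F (inv_dom' γ.exists_rep.choose_spec.choose_spec.choose)
    (inv_act γ.exists_rep.choose_spec.choose_spec.choose)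

theorem Arrow.id_eq (F : TightFilter S) (e : S) (he : e ∈ F) :
    Arrow.id F = Arrow.mk e F F (unit_dom he) (act_unit he) := by
  refine Subtype.ext (germ_eq (F.nonempty.some * e) (F.mul_mem _ F.nonempty.some_mem _ he) ?_)
  have h1 := F.idem _ F.nonempty.some_mem
  have h2 := F.idem _ he
  have h1' : _ * _ = _ := h1
  have h2' : e * e = e := h2
  rw [← mul_assoc, h1', idem_comm h1 h2, ← mul_assoc, h2']

theorem Arrow.comp_mk {F F' F'' : TightFilter S} (s t : S) (hs : star s * s ∈ F)
    (hF : F.act s hs = F') (ht : star t * t ∈ F') (hF' : F'.act t ht = F'') :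
    (Arrow.mk s F F' hs hF).comp (Arrow.mk t F' F'' ht hF') =
      Arrow.mk (t * s) F F'' (comp_dom' hF ht) (comp_act hF hF') := by
  have h1 := (Arrow.mk s F F' hs hF).exists_rep.choose_spec.choose_spec.choose_spec
  have h2 := (Arrow.mk t F' F'' ht hF').exists_rep.choose_spec.choose_spec.choose_spec
  exact Subtype.ext (comp_congr hF (congrArg Subtype.val h1) (congrArg Subtype.val h2)).symm

theorem Arrow.inv_mk {F F' : TightFilter S} (s : S) (hs : star s * s ∈ F)
    (hF : F.act s hs = F') :
    (Arrow.mk s F F' hs hF).inv = Arrow.mk (star s) F' F (inv_dom' hF) (inv_act hF) := by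
  have h1 := (Arrow.mk s F F' hs hF).exists_rep.choose_spec.choose_spec.choose_spec
  exact Subtype.ext (inv_congr hF (congrArg Subtype.val h1)).symm

/-- The tight groupoid as a groupoid whose objects are the tight filters and whose arrows are the
germs. -/
noncomputable instance : CategoryTheory.Groupoid (TightFilter S) where
  Hom F F' := Arrow F F'
  id F := Arrow.id F
  comp γ δ := γ.comp δ
  inv γ := γ.inv
  id_comp := by
    rintro F F' γ
    obtain ⟨s, hs, h, rfl⟩ := γ.exists_rep
    rw [Arrow.id_eq F _ hs, Arrow.comp_mk]
    exact Subtype.ext (germ_congr rfl (by rw [← mul_assoc, mul_star_mul]))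
  comp_id := by
    rintro F F' γ
    obtain ⟨s, hs, rfl, rfl⟩ := γ.exists_rep
    rw [Arrow.id_eq _ _ (inv_dom hs), Arrow.comp_mk]
    exact Subtype.ext (germ_congr rfl (by rw [star_star_self, mul_star_mul]))
  assoc := by
    rintro F F' F'' F''' γ δ ε
    obtain ⟨s, hs, h, rfl⟩ := γ.exists_rep
    obtain ⟨t, ht, h', rfl⟩ := δ.exists_rep
    obtain ⟨r, hr, h'', rfl⟩ := ε.exists_rep
    simp only [Arrow.comp_mk]
    exact Subtype.ext (germ_congr rfl (mul_assoc _ _ _).symm)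
  inv_comp := by
    rintro F F' γ
    obtain ⟨s, hs, rfl, rfl⟩ := γ.exists_rep
    rw [Arrow.id_eq _ _ (inv_dom hs), Arrow.inv_mk, Arrow.comp_mk]
    exact Subtype.ext (germ_congr rfl (by rw [star_star_self]))
  comp_inv := by
    rintro F F' γ
    obtain ⟨s, hs, h, rfl⟩ := γ.exists_rep
    rw [Arrow.id_eq _ _ hs, Arrow.inv_mk, Arrow.comp_mk]

end TightGroupoid

end TightGroupoid

/-! ### Inverse hulls -/

section InverseHull

variable (M : Type*) [Monoid M] [IsLeftCancelMul M]

open Classical in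
/-- Left multiplication by `m` as a partial bijection of `M`. -/
noncomputable def leftMulPEquiv {M : Type*} [Monoid M] [IsLeftCancelMul M] (m : M) : M ≃. M where
  toFun k := some (m * k)
  invFun n := if h : ∃ k, m * k = n then some h.choose else none
  inv k n := by
    constructor
    · intro h
      split_ifs at h with hk
      have h1 := hk.choose_spec
      rw [Option.some.inj h] at h1
      rw [h1]
    · intro h
      have h1 : ∃ k, m * k = n := ⟨k, Option.some.inj h⟩
      rw [dif_pos h1]
      exact congrArg some (mul_left_cancel (h1.choose_spec.trans (Option.some.inj h).symm))

/-- The partial bijections of `M` generated by the left multiplications under composition and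
inversion, together with the empty map `⊥` (which is a composite `(m ⬝)⁻¹ ∘ (m' ⬝)` anyway as soon
as two elements `m`, `m'` have no common right multiple). -/
inductive InInverseHull : (M ≃. M) → Prop
  | leftMul (m : M) : InInverseHull (leftMulPEquiv m)
  | bot : InInverseHull ⊥
  | symm {f : M ≃. M} : InInverseHull f → InInverseHull f.symm
  | trans {f g : M ≃. M} : InInverseHull f → InInverseHull g → InInverseHull (f.trans g)

/-- The inverse hull (with zero) of a left cancellative monoid. -/
def InverseHull : Type _ := {f : M ≃. M // InInverseHull M f}

/-- The product of partial bijections is composition (the right factor is applied first), `star`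
is inversion and `0` is the empty map. -/
instance : InverseSemigroupWithZero (InverseHull M) where
  mul s t := ⟨t.1.trans s.1, t.2.trans s.2⟩
  zero := ⟨⊥, .bot⟩
  star s := ⟨s.1.symm, s.2.symm⟩
  mul_assoc s t r := Subtype.ext (PEquiv.trans_assoc r.1 t.1 s.1).symm
  zero_mul s := Subtype.ext (PEquiv.trans_bot s.1)
  mul_zero s := Subtype.ext (PEquiv.bot_trans s.1)
  mul_star_mul s := by
    obtain ⟨s, hs⟩ := s
    refine Subtype.ext ?_
    change s.trans (s.symm.trans s) = s
    refine PEquiv.ext fun a => Option.ext fun b => ?_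
    simp only [PEquiv.trans_eq_some, PEquiv.eq_some_iff]
    constructor
    · rintro ⟨c, hc, d, hd, hb⟩
      rwa [s.inj hc hd]
    · intro h
      exact ⟨b, h, a, h, h⟩
  star_self_star s := by
    obtain ⟨s, hs⟩ := s
    refine Subtype.ext ?_
    change s.symm.trans (s.trans s.symm) = s.symm
    refine PEquiv.ext fun a => Option.ext fun b => ?_
    simp only [PEquiv.trans_eq_some, PEquiv.eq_some_iff]
    constructor
    · rintro ⟨c, hc, d, hd, hb⟩
      obtain rfl : a = d := Option.some.inj (hc.symm.trans hd)
      exact hb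
    · intro h
      exact ⟨b, h, a, h, h⟩
  star_unique s t h1 h2 := by
    obtain ⟨s, hs⟩ := s
    obtain ⟨t, ht⟩ := t
    replace h1 : s.trans (t.trans s) = s := congrArg Subtype.val h1
    replace h2 : t.trans (s.trans t) = t := congrArg Subtype.val h2
    refine Subtype.ext ?_
    change t = s.symm
    refine PEquiv.ext fun a => Option.ext fun b => ?_
    rw [PEquiv.eq_some_iff]
    constructor
    · intro h
      have h' := h
      rw [← h2] at h'
      simp only [PEquiv.trans_eq_some] at h'
      obtain ⟨c, hc, d, hd, hb⟩ := h'
      obtain rfl : b = c := Option.some.inj (h.symm.trans hc)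
      obtain rfl : a = d := t.inj h hb
      exact hd
    · intro h
      have h' := h
      rw [← h1] at h'
      simp only [PEquiv.trans_eq_some] at h'
      obtain ⟨c, hc, d, hd, hb⟩ := h'
      obtain rfl : a = c := Option.some.inj (h.symm.trans hc)
      obtain rfl : b = d := s.inj h hb
      exact hd

end InverseHull

/-! ### Self-similar groups -/

/-- A self-similar group `G` over the alphabet `X`: a faithful length-preserving action of `G` on
the words over `X` such that for all `g` and `x` there is `h` (the section of `g` at `x`) with
`g (x w) = g (x) h (w)` for all words `w`. -/
class SelfSimilarGroup (G X : Type*) [Group G] [MulAction G (List X)] : Prop where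
  faithful : ∀ g h : G, (∀ w : List X, g • w = h • w) → g = h
  length_smul : ∀ (g : G) (w : List X), (g • w).length = w.length
  exists_section : ∀ (g : G) (x : X), ∃ h : G, ∀ w : List X, g • (x :: w) = g • [x] ++ h • w

namespace SelfSimilarGroup

variable {G X : Type*} [Group G] [MulAction G (List X)] [SelfSimilarGroup G X]

/-- The section `g|_x` at a letter. -/
noncomputable def sectionLetter (g : G) (x : X) : G := (exists_section g x).choose

/-- The section `g|_w` at a word: `g|_{x v} = (g|_x)|_v`. -/
noncomputable def sec (g : G) : List X → G
  | [] => g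
  | x :: v => sec (sectionLetter g x) v

theorem smul_append (g : G) (u v : List X) : g • (u ++ v) = g • u ++ sec g u • v := by
  induction u generalizing g with
  | nil =>
    have : g • ([] : List X) = [] := List.eq_nil_of_length_eq_zero (length_smul g [])
    rw [List.nil_append, this, List.nil_append]; rfl
  | cons x u ih =>
    have h := (exists_section g x).choose_spec
    rw [List.cons_append, h, h u, List.append_assoc]
    exact congrArg _ (ih _)

theorem sec_unique {g h : G} {u : List X} (H : ∀ v, g • (u ++ v) = g • u ++ h • v) :
    h = sec g u :=
  faithful _ _ fun v => List.append_cancel_left ((H v).symm.trans (smul_append g u v))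

theorem smul_nil (g : G) : g • ([] : List X) = [] :=
  List.eq_nil_of_length_eq_zero (length_smul g [])

theorem sec_append (g : G) (u v : List X) : sec g (u ++ v) = sec (sec g u) v := by
  refine (sec_unique fun w => ?_).symm
  rw [List.append_assoc, smul_append, smul_append, smul_append, List.append_assoc]

theorem sec_mul (g h : G) (u : List X) : sec (g * h) u = sec g (h • u) * sec h u := by
  refine (sec_unique fun w => ?_).symm
  rw [mul_smul, mul_smul, mul_smul, smul_append, smul_append]

theorem sec_one (u : List X) : sec (1 : G) u = 1 :=
  (sec_unique fun w => by rw [one_smul, one_smul, one_smul]).symm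

end SelfSimilarGroup

section SelfSimilar

open SelfSimilarGroup

/-- The set `X* G` of pairs `u g` with `u` a word and `g ∈ G`. -/
@[ext]
structure WordMonoid (G X : Type*) where
  word : List X
  elt : G

/-- The product `u g ⬝ v h = u g(v) g|_v h`. -/
noncomputable instance (G X : Type*) [Group G] [MulAction G (List X)] [SelfSimilarGroup G X] :
    Monoid (WordMonoid G X) where
  mul a b := ⟨a.word ++ a.elt • b.word, sec a.elt b.word * b.elt⟩
  one := ⟨[], 1⟩
  mul_assoc a b c := by
    refine WordMonoid.ext ?_ ?_
    · change (a.word ++ a.elt • b.word) ++ (sec a.elt b.word * b.elt) • c.word =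
        a.word ++ a.elt • (b.word ++ b.elt • c.word)
      rw [smul_append, mul_smul, List.append_assoc]
    · change sec (sec a.elt b.word * b.elt) c.word * c.elt =
        sec a.elt (b.word ++ b.elt • c.word) * (sec b.elt c.word * c.elt)
      rw [sec_mul, sec_append, mul_assoc]
  one_mul a := by
    refine WordMonoid.ext ?_ ?_
    · change [] ++ (1 : G) • a.word = a.word
      rw [one_smul, List.nil_append]
    · change sec (1 : G) a.word * a.elt = a.elt
      rw [sec_one, one_mul]
  mul_one a := by
    refine WordMonoid.ext ?_ ?_
    · change a.word ++ a.elt • ([] : List X) = a.word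
      rw [smul_nil, List.append_nil]
    · change sec a.elt ([] : List X) * 1 = a.elt
      rw [mul_one]; rfl

instance (G X : Type*) [Group G] [MulAction G (List X)] [SelfSimilarGroup G X] :
    IsLeftCancelMul (WordMonoid G X) where
  mul_left_cancel a b c h := by
    have h1 : a.word ++ a.elt • b.word = a.word ++ a.elt • c.word := congrArg WordMonoid.word h
    have h2 : sec a.elt b.word * b.elt = sec a.elt c.word * c.elt := congrArg WordMonoid.elt h
    have h3 : b.word = c.word := MulAction.injective a.elt (List.append_cancel_left h1)
    rw [h3] at h2
    exact WordMonoid.ext h3 (mul_left_cancel h2)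

/-- The inverse semigroup associated to the self-similar group `G` over `X`. -/
abbrev SelfSimilarGroup.inverseSemigroup (G X : Type*) [Group G] [MulAction G (List X)]
    [SelfSimilarGroup G X] : Type _ :=
  InverseHull (WordMonoid G X)

/-! ### Automata, contracting groups and the nucleus -/

/-- A finite automaton in `G`: a finite subset closed under taking sections. -/
structure FiniteAutomaton (G X : Type*) [Group G] [MulAction G (List X)]
    [SelfSimilarGroup G X] where
  carrier : Set G
  finite : carrier.Finite
  sec_mem : ∀ g ∈ carrier, ∀ x : X, sectionLetter g x ∈ carrier

/-- The finite automaton `N` absorbs all deep sections: for every `g ∈ G` there is `n` with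
`g|_w ∈ N` for all words `w` of length `n`. -/
def FiniteAutomaton.Absorbing {G X : Type*} [Group G] [MulAction G (List X)]
    [SelfSimilarGroup G X] (N : FiniteAutomaton G X) : Prop :=
  ∀ g : G, ∃ n : ℕ, ∀ w : List X, w.length = n → sec g w ∈ N.carrier

/-- A self-similar group is contracting if some finite automaton absorbs all deep sections. -/
def IsContracting (G X : Type*) [Group G] [MulAction G (List X)] [SelfSimilarGroup G X] : Prop :=
  ∃ N : FiniteAutomaton G X, N.Absorbing

/-- The nucleus: the smallest absorbing finite automaton of a contracting group (the intersection
of all of them). -/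
def nucleus (G X : Type*) [Group G] [MulAction G (List X)] [SelfSimilarGroup G X] : Set G :=
  ⋂ N : {N : FiniteAutomaton G X // N.Absorbing}, N.1.carrier

theorem FiniteAutomaton.sec_mem' {G X : Type*} [Group G] [MulAction G (List X)]
    [SelfSimilarGroup G X] (N : FiniteAutomaton G X) {g : G} (hg : g ∈ N.carrier) (w : List X) :
    sec g w ∈ N.carrier := by
  induction w generalizing g with
  | nil => exact hg
  | cons x w ih => exact ih (N.sec_mem g hg x)

/-- The nucleus of a contracting group is indeed an absorbing finite automaton, and it is contained
in every other one. -/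
theorem nucleus_isLeast {G X : Type*} [Group G] [MulAction G (List X)] [SelfSimilarGroup G X]
    (hG : IsContracting G X) :
    IsLeast {C : Set G | ∃ N : FiniteAutomaton G X, N.Absorbing ∧ N.carrier = C}
      (nucleus G X) := by
  obtain ⟨N₀, hN₀⟩ := hG
  refine ⟨⟨⟨nucleus G X, N₀.finite.subset (Set.iInter_subset _ (⟨N₀, hN₀⟩ : {N // _})), ?_⟩,
    ?_, rfl⟩, ?_⟩
  · intro g hg x
    exact Set.mem_iInter.2 fun N => N.1.sec_mem g (Set.mem_iInter.1 hg N) x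
  · intro g
    have hex : ∀ h : G, ∃ n : ℕ, h ∈ N₀.carrier → h ∉ nucleus G X →
        ∀ w : List X, n ≤ w.length → sec g w ≠ h := by
      intro h
      by_cases hh : h ∈ nucleus G X
      · exact ⟨0, fun _ h' => (h' hh).elim⟩
      · obtain ⟨N, hN⟩ := not_forall.1 (fun H => hh (Set.mem_iInter.2 H))
        obtain ⟨n, hn⟩ := N.2 g
        refine ⟨n, fun _ _ w hw heq => hN ?_⟩
        rw [← heq, ← List.take_append_drop n w, sec_append]
        exact N.1.sec_mem' (hn _ (by rw [List.length_take, min_eq_left hw])) _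
    choose b hb using hex
    obtain ⟨m, hm⟩ := hN₀ g
    refine ⟨m + ∑ h ∈ N₀.finite.toFinset, b h, fun w hw => ?_⟩
    have h1 : sec g w ∈ N₀.carrier := by
      rw [← List.take_append_drop m w, sec_append]
      exact N₀.sec_mem' (hm _ (by rw [List.length_take, hw]; omega)) _
    by_contra h2
    refine hb _ h1 h2 w ?_ rfl
    have := Finset.single_le_sum (f := b) (fun _ _ => Nat.zero_le _)
      (N₀.finite.mem_toFinset.2 h1)
    omega
  · rintro C ⟨N, hN, rfl⟩
    exact Set.iInter_subset _ (⟨N, hN⟩ : {N // _})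

/-! ### Finite digraphs -/

/-- A vertex of a digraph (given by its edge relation) lies in a minimal strongly connected
component if it can be reached back from every vertex that is reachable from it. -/
def IsMinimalVertex {V : Type*} (edge : V → V → Prop) (v : V) : Prop :=
  ∀ v', Relation.ReflTransGen edge v v' → Relation.ReflTransGen edge v' v

/-- A vertex of a finite digraph is essential if it is reachable from a directed cycle. -/
def IsEssentialVertex {V : Type*} (edge : V → V → Prop) (v : V) : Prop :=
  ∃ c, Relation.TransGen edge c c ∧ Relation.ReflTransGen edge c v

/-! ### The simplicity graph of an automaton -/

namespace FiniteAutomaton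

variable {G X : Type*} [Group G] [MulAction G (List X)] [SelfSimilarGroup G X]
  (A : FiniteAutomaton G X)

/-- The section of a state at a letter, as a state. -/
noncomputable def next (g : A.carrier) (x : X) : A.carrier :=
  ⟨sectionLetter g.1 x, A.sec_mem g.1 g.2 x⟩

/-- The equivalence relation `x ⬝ ≡` on the states: `g` and `h` are related iff `g (x) = h (x)`
and `g|_x ≡ h|_x`. -/
def letterAct (x : X) (r : Setoid A.carrier) : Setoid A.carrier where
  r g h := g.1 • [x] = h.1 • [x] ∧ r (A.next g x) (A.next h x)
  iseqv :=
    { refl := fun _ => ⟨rfl, r.refl _⟩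
      symm := fun h => ⟨h.1.symm, r.symm h.2⟩
      trans := fun h h' => ⟨h.1.trans h'.1, r.trans h.2 h'.2⟩ }

/-- The equivalence relation `≡_w` on the states: `≡_∅` is equality, and `≡_{x w}` is
`x ⬝ ≡_w`. -/
def wordRel : List X → Setoid A.carrier
  | [] => ⊥
  | x :: w => A.letterAct x (wordRel w)

/-- The vertices of the simplicity graph `Σ_A`: the relations `≡_w`. -/
def Vertex : Type _ := {r : Setoid A.carrier // ∃ w : List X, r = A.wordRel w}

/-- The vertex `≡_w`. -/
def vertex (w : List X) : A.Vertex := ⟨A.wordRel w, w, rfl⟩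

/-- The simplicity graph `Σ_A`: its edges labelled `x` are `≡ ⟶ x ⬝ ≡`. -/
def LabelledEdge (x : X) (v v' : A.Vertex) : Prop := v'.1 = A.letterAct x v.1

/-- The edge relation of the simplicity graph, without labels. -/
def Edge (v v' : A.Vertex) : Prop := ∃ x : X, A.LabelledEdge x v v'

/-- `V_u`, the set of all vertices `≡_{u w}`. -/
def reachSet (u : List X) : Set A.Vertex := {v | ∃ w : List X, v = A.vertex (u ++ w)}

/-- `V_min`, the vertices in the minimal components of the simplicity graph. -/
def minimalVertices : Set A.Vertex := {v | IsMinimalVertex A.Edge v}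

/-- `V_ess`, the essential vertices of the simplicity graph. -/
def essentialVertices : Set A.Vertex := {v | IsEssentialVertex A.Edge v}

end FiniteAutomaton

end SelfSimilar

/-!
The tight filters at which `s` and `t` have the same germ form an open set, and the groupoid is
Hausdorff exactly when all these sets are also closed. Tight filters correspond to infinite words,
and for `s = g`, `t = 1` the set consists of the infinite words with a prefix strongly fixed by `g`.
By compactness it is closed iff the minimal strongly fixed words have bounded length. Since
`g ≡_w h` says that `h⁻¹ g` strongly fixes `w`, such a bound `n` for all `h⁻¹ g` with `g` and `h` in
the automaton says that `≡_w` depends only on the first `n` letters of `w`. It extends to all of `G`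
because every element has its deep sections in the automaton.
-/

namespace TightFilter

variable {S : Type*} [InverseSemigroupWithZero S]

theorem isClopen_setOf_mem {e : S} (he : IsIdempotentElem e) :
    IsClopen {F : TightFilter S | e ∈ F} :=
  ⟨⟨TopologicalSpace.isOpen_generateFrom_of_mem ⟨e, he, Or.inr rfl⟩⟩,
    TopologicalSpace.isOpen_generateFrom_of_mem ⟨e, he, Or.inl rfl⟩⟩

theorem isOpen_setOf_mem (e : S) : IsOpen {F : TightFilter S | e ∈ F} := by
  by_cases he : IsIdempotentElem e
  · exact (isClopen_setOf_mem he).isOpen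
  · convert isOpen_empty
    exact Set.eq_empty_of_forall_notMem fun F hF => he (F.idem e hF)

instance : TotallySeparatedSpace (TightFilter S) := by
  refine totallySeparatedSpace_iff_exists_isClopen.2 fun F F' hne => ?_
  by_contra! H
  refine hne (TightFilter.ext (Set.ext fun e => ⟨fun he => ?_, fun he => ?_⟩))
  · exact Set.notMem_compl_iff.1 (H _ (isClopen_setOf_mem (F.idem e he)) he)
  · by_contra he'
    exact H _ (isClopen_setOf_mem (F'.idem e he)).compl he' (not_not_intro he)

end TightFilter

namespace TightGroupoid

open InverseSemigroupWithZero

variable {S : Type*} [InverseSemigroupWithZero S]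

theorem exists_eq_germ (γ : TightGroupoid S) : ∃ s F h, γ = germ s F h := by
  induction γ using Quotient.inductionOn with
  | h p => exact ⟨p.elt, p.filter, p.dom, rfl⟩

/-- The basic open set `Θ(s, U)` of germs of `s` at the filters in `U`. -/
def basicOpen (s : S) (U : Set (TightFilter S)) : Set (TightGroupoid S) :=
  {γ | ∃ (F : TightFilter S) (h : star s * s ∈ F), F ∈ U ∧ γ = germ s F h}

theorem isOpen_basicOpen (s : S) {U : Set (TightFilter S)} (hU : IsOpen U) :
    IsOpen (basicOpen s U) :=
  TopologicalSpace.isOpen_generateFrom_of_mem ⟨s, U, hU, rfl⟩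

theorem continuous_source : Continuous (source : TightGroupoid S → TightFilter S) := by
  refine continuous_def.2 fun U hU => ?_
  have hpre : source ⁻¹' U = ⋃ s : S, basicOpen s U := by
    ext γ
    rw [Set.mem_iUnion]
    constructor
    · intro hγ
      obtain ⟨s, F, h, rfl⟩ := exists_eq_germ γ
      exact ⟨s, F, h, hγ, rfl⟩
    · rintro ⟨s, F, h, hF, rfl⟩
      exact hF
  rw [hpre]
  exact isOpen_iUnion fun s => isOpen_basicOpen s hU

theorem germ_eq_germ_iff {s t : S} {F : TightFilter S} {hs : star s * s ∈ F}
    {ht : star t * t ∈ F} : germ s F hs = germ t F ht ↔ ∃ e ∈ F, s * e = t * e :=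
  ⟨exists_of_germ_eq, fun ⟨e, he, h⟩ => germ_eq e he h⟩

theorem germ_mem_basicOpen_iff {s t : S} {F : TightFilter S} {hs : star s * s ∈ F}
    {U : Set (TightFilter S)} :
    germ s F hs ∈ basicOpen t U ↔ F ∈ U ∧ star t * t ∈ F ∧ ∃ e ∈ F, s * e = t * e := by
  constructor
  · rintro ⟨F', ht, hF', h⟩
    obtain rfl : F = F' := congrArg source h
    exact ⟨hF', ht, germ_eq_germ_iff.1 h⟩
  · rintro ⟨hF, ht, h⟩
    exact ⟨F, ht, hF, germ_eq_germ_iff.2 h⟩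

/-- The filters at which `s` and `t` are both defined and have the same germ. -/
def eqLocus (s t : S) : Set (TightFilter S) :=
  {F | star s * s ∈ F ∧ star t * t ∈ F ∧ ∃ e ∈ F, s * e = t * e}

theorem isOpen_eqLocus (s t : S) : IsOpen (eqLocus s t) := by
  have h : eqLocus s t = {F | star s * s ∈ F} ∩ ({F | star t * t ∈ F} ∩
      ⋃ e : {e : S // s * e = t * e}, {F | e.1 ∈ F}) := by
    ext F
    simp only [eqLocus, Set.mem_inter_iff, Set.mem_ofPred_eq, Set.mem_iUnion, Subtype.exists,
      exists_prop, and_comm]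
  rw [h]
  exact (TightFilter.isOpen_setOf_mem _).inter ((TightFilter.isOpen_setOf_mem _).inter
    (isOpen_iUnion fun e => TightFilter.isOpen_setOf_mem e.1))

theorem continuous_germ (s : S) :
    Continuous fun F : {F : TightFilter S // star s * s ∈ F} => germ s F.1 F.2 := by
  refine continuous_generateFrom_iff.2 ?_
  rintro _ ⟨t, U, hU, rfl⟩
  have hpre : (fun F : {F : TightFilter S // star s * s ∈ F} => germ s F.1 F.2) ⁻¹' basicOpen t U =
      Subtype.val ⁻¹' (U ∩ eqLocus s t) := by
    ext F
    rw [Set.mem_preimage, germ_mem_basicOpen_iff]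
    exact and_congr_right fun _ => (and_iff_right F.2).symm
  exact hpre ▸ (hU.inter (isOpen_eqLocus s t)).preimage continuous_subtype_val

theorem isClosed_eqLocus [T2Space (TightGroupoid S)] (s t : S) : IsClosed (eqLocus s t) := by
  set D : Set (TightFilter S) := {F | star s * s ∈ F} ∩ {F | star t * t ∈ F}
  have hD : IsClosed D := (TightFilter.isClopen_setOf_mem (idem_star_mul s)).isClosed.inter
    (TightFilter.isClopen_setOf_mem (idem_star_mul t)).isClosed
  have hs : Continuous fun F : D => germ s F.1 F.2.1 :=
    (continuous_germ s).comp (continuous_subtype_val.subtype_mk fun F => F.2.1)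
  have ht : Continuous fun F : D => germ t F.1 F.2.2 :=
    (continuous_germ t).comp (continuous_subtype_val.subtype_mk fun F => F.2.2)
  convert hD.isClosedEmbedding_subtypeVal.isClosedMap _ (isClosed_eq hs ht)
  ext F
  simp only [germ_eq_germ_iff, Set.mem_image, Set.mem_ofPred_eq, Subtype.exists, exists_and_left,
    exists_prop, exists_eq_right_right]
  exact ⟨fun h => ⟨h.2.2, h.1, h.2.1⟩, fun h => ⟨h.2.1, h.2.2, h.1⟩⟩

theorem t2Space_iff_isClosed_eqLocus :
    T2Space (TightGroupoid S) ↔ ∀ s t : S, IsClosed (eqLocus s t) := by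
  refine ⟨fun _ => isClosed_eqLocus, fun H => ⟨fun γ δ hγδ => ?_⟩⟩
  by_cases hsource : source γ = source δ
  · obtain ⟨s, F, hs, rfl⟩ := exists_eq_germ γ
    obtain ⟨t, F', ht, rfl⟩ := exists_eq_germ δ
    obtain rfl : F = F' := hsource
    refine ⟨basicOpen s (eqLocus s t)ᶜ, basicOpen t (eqLocus s t)ᶜ,
      isOpen_basicOpen s (H s t).isOpen_compl, isOpen_basicOpen t (H s t).isOpen_compl,
      ⟨F, hs, fun hF => hγδ (germ_eq_germ_iff.2 hF.2.2), rfl⟩,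
      ⟨F, ht, fun hF => hγδ (germ_eq_germ_iff.2 hF.2.2), rfl⟩, Set.disjoint_left.2 ?_⟩
    rintro _ ⟨F', hs', hF', rfl⟩ hF't
    exact hF' ⟨hs', (germ_mem_basicOpen_iff.1 hF't).2⟩
  · exact separated_by_continuous continuous_source hsource

end TightGroupoid

namespace InverseHull

open InverseSemigroupWithZero

variable {M : Type*} [Monoid M] [IsLeftCancelMul M]

section Apply

variable {s t : InverseHull M} {m m' : M}

theorem mul_apply_eq_some : (s * t).1 m = some m' ↔ ∃ k, t.1 m = some k ∧ s.1 k = some m' :=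
  PEquiv.trans_eq_some _ _ _ _

theorem star_apply_eq_some : (star s).1 m = some m' ↔ s.1 m' = some m :=
  PEquiv.eq_some_iff s.1

theorem zero_apply_ne_some : (0 : InverseHull M).1 m ≠ some m' :=
  Option.some_ne_none _ ∘ Eq.symm

theorem ext_some (h : ∀ m m', s.1 m = some m' ↔ t.1 m = some m') : s = t :=
  Subtype.ext (PEquiv.ext fun m => Option.ext fun m' => h m m')

theorem ne_zero_iff : s ≠ 0 ↔ ∃ m m', s.1 m = some m' := by
  refine ⟨fun hs => ?_, fun ⟨m, m', h⟩ hs => zero_apply_ne_some (hs ▸ h)⟩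
  by_contra! H
  exact hs (ext_some fun m m' => iff_of_false (H m m') zero_apply_ne_some)

theorem apply_mul (h : s.1 m = some m') (k : M) : s.1 (m * k) = some (m' * k) := by
  obtain ⟨f, hf⟩ := s
  change f m = some m' at h
  change f (m * k) = some (m' * k)
  induction hf generalizing m m' with
  | leftMul a =>
    cases h
    exact congrArg some (mul_assoc a m k).symm
  | bot => cases h
  | symm _ ih => exact (PEquiv.eq_some_iff _).2 (ih ((PEquiv.eq_some_iff _).1 h))
  | trans _ _ ih₁ ih₂ =>
    obtain ⟨c, hc, hc'⟩ := (PEquiv.trans_eq_some _ _ _ _).1 h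
    exact (PEquiv.trans_eq_some _ _ _ _).2 ⟨c * k, ih₁ hc, ih₂ hc'⟩

theorem apply_eq_self_of_isIdempotentElem (hs : IsIdempotentElem s) (h : s.1 m = some m') :
    m' = m := by
  obtain ⟨k, hk, hk'⟩ := mul_apply_eq_some.1 (hs.symm ▸ h : (s * s).1 m = some m')
  obtain rfl : m' = k := Option.some.inj (h.symm.trans hk)
  exact s.1.inj hk' h

end Apply

/-- The partial bijection `k ↦ m k`. -/
noncomputable def ofMul (m : M) : InverseHull M := ⟨leftMulPEquiv m, .leftMul m⟩

/-- The partial bijection `b k ↦ a k`, written `a b*` in the literature. -/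
noncomputable def frac (a b : M) : InverseHull M := ofMul a * star (ofMul b)

theorem ofMul_apply_eq_some {m k k' : M} : (ofMul m).1 k = some k' ↔ m * k = k' :=
  Option.some_inj

theorem ofMul_mul (a b : M) : ofMul (a * b) = ofMul a * ofMul b := by
  refine ext_some fun m m' => ?_
  simp only [mul_apply_eq_some, ofMul_apply_eq_some, exists_eq_left', mul_assoc]

theorem mul_ofMul_one (s : InverseHull M) : s * ofMul 1 = s := by
  refine ext_some fun m m' => ?_
  simp only [mul_apply_eq_some, ofMul_apply_eq_some, one_mul, exists_eq_left']

theorem star_ofMul_mul_ofMul (m : M) : star (ofMul m) * ofMul m = ofMul 1 := by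
  refine ext_some fun k k' => ?_
  simp only [mul_apply_eq_some, star_apply_eq_some, ofMul_apply_eq_some, exists_eq_left',
    mul_right_inj, one_mul, @eq_comm M k']

theorem isIdempotentElem_ofMul_one : IsIdempotentElem (ofMul (1 : M)) :=
  mul_ofMul_one _

theorem star_ofMul_one : star (ofMul (1 : M)) = ofMul 1 :=
  star_idem isIdempotentElem_ofMul_one

theorem frac_one (a : M) : frac a 1 = ofMul a := by
  rw [frac, star_ofMul_one, mul_ofMul_one]

theorem star_frac (a b : M) : star (frac a b) = frac b a := by
  rw [frac, star_mul_rev, star_star_self, frac]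

theorem isIdempotentElem_frac_self (a : M) : IsIdempotentElem (frac a a) :=
  idem_mul_star (ofMul a)

theorem frac_apply_eq_some {a b m m' : M} :
    (frac a b).1 m = some m' ↔ ∃ k, b * k = m ∧ a * k = m' := by
  simp only [frac, mul_apply_eq_some, star_apply_eq_some, ofMul_apply_eq_some]

theorem frac_apply_self (a b : M) : (frac a b).1 b = some a :=
  frac_apply_eq_some.2 ⟨1, mul_one b, mul_one a⟩

theorem frac_ne_zero (a b : M) : frac a b ≠ 0 :=
  ne_zero_iff.2 ⟨b, a, frac_apply_self a b⟩

theorem frac_self_apply_eq_some {b m m' : M} : (frac b b).1 m = some m' ↔ b ∣ m ∧ m' = m := by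
  rw [frac_apply_eq_some]
  constructor
  · rintro ⟨k, rfl, rfl⟩
    exact ⟨dvd_mul_right b k, rfl⟩
  · rintro ⟨⟨k, rfl⟩, rfl⟩
    exact ⟨k, rfl, rfl⟩

theorem frac_left_inj {a b c : M} : frac a b = frac c b ↔ a = c :=
  ⟨fun h => Option.some.inj <| by rw [← frac_apply_self a b, h, frac_apply_self],
    congrArg (frac · b)⟩

theorem mul_frac_self {s : InverseHull M} {a b : M} (h : s.1 b = some a) :
    s * frac b b = frac a b := by
  have hs : s * ofMul b = ofMul a := ext_some fun k k' => by
    simp only [mul_apply_eq_some, ofMul_apply_eq_some, exists_eq_left', apply_mul h k,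
      Option.some_inj]
  rw [frac, ← mul_assoc, hs, frac]

theorem frac_self_mul_frac_self_eq_left_iff {a b : M} :
    frac a a * frac b b = frac a a ↔ b ∣ a := by
  constructor
  · intro h
    obtain ⟨k, hk, -⟩ := mul_apply_eq_some.1 (h.symm ▸ frac_apply_self a a)
    exact (frac_self_apply_eq_some.1 hk).1
  · intro h
    rw [idem_comm (isIdempotentElem_frac_self a) (isIdempotentElem_frac_self b)]
    exact mul_frac_self (frac_self_apply_eq_some.2 ⟨h, rfl⟩)

theorem frac_self_mul_frac_self_ne_zero_iff {a b : M} :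
    frac a a * frac b b ≠ 0 ↔ ∃ m, a ∣ m ∧ b ∣ m := by
  simp only [ne_zero_iff, mul_apply_eq_some, frac_self_apply_eq_some]
  constructor
  · rintro ⟨_, _, m, ⟨hb, rfl⟩, ha, -⟩
    exact ⟨m, ha, hb⟩
  · rintro ⟨m, ha, hb⟩
    exact ⟨m, m, m, ⟨hb, rfl⟩, ha, rfl⟩

theorem frac_mul_mul_frac (a c d r : M) :
    frac a (c * r) * frac c d = frac a (d * r) :=
  calc frac a (c * r) * frac c d
      = ofMul a * star (ofMul r) * (star (ofMul c) * ofMul c) * star (ofMul d) := by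
        simp only [frac, ofMul_mul, star_mul_rev, mul_assoc]
    _ = ofMul a * star (ofMul r) * star (ofMul d) := by rw [star_ofMul_mul_ofMul, mul_ofMul_one]
    _ = frac a (d * r) := by simp only [frac, ofMul_mul, star_mul_rev, mul_assoc]

theorem frac_mul_frac_mul (a b d r : M) : frac a b * frac (b * r) d = frac (a * r) d := by
  rw [← star_frac d, ← star_frac b, ← star_mul_rev, frac_mul_mul_frac, star_frac]

/-- A monoid is right rigid if two of its principal right ideals are either disjoint or comparable;
here `∣` is left divisibility, `a ∣ m ↔ ∃ c, m = a * c`. -/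
class IsRightRigid (M : Type*) [Monoid M] : Prop where
  dvd_or_dvd : ∀ a b m : M, a ∣ m → b ∣ m → a ∣ b ∨ b ∣ a

section IsRightRigid

variable [IsRightRigid M]

theorem frac_self_mul_frac_self_ne_zero_iff_dvd_or_dvd {a b : M} :
    frac a a * frac b b ≠ 0 ↔ a ∣ b ∨ b ∣ a := by
  rw [frac_self_mul_frac_self_ne_zero_iff]
  constructor
  · rintro ⟨m, ha, hb⟩
    exact IsRightRigid.dvd_or_dvd a b m ha hb
  · rintro (h | h)
    · exact ⟨b, h, dvd_rfl⟩
    · exact ⟨a, dvd_rfl, h⟩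

theorem frac_mul_frac_eq_zero_or_eq_frac (a b c d : M) :
    frac a b * frac c d = 0 ∨ ∃ a' b', frac a b * frac c d = frac a' b' := by
  by_cases h : b ∣ c ∨ c ∣ b
  · right
    rcases h with ⟨r, rfl⟩ | ⟨r, rfl⟩
    · exact ⟨_, _, frac_mul_frac_mul a b d r⟩
    · exact ⟨_, _, frac_mul_mul_frac a c d r⟩
  · left
    have h₀ : frac b b * frac c c = 0 := by
      by_contra h₀
      exact h (frac_self_mul_frac_self_ne_zero_iff_dvd_or_dvd.1 h₀)
    rw [← mul_frac_self (frac_apply_self a b), ← mul_one c, ← frac_mul_frac_mul c c d 1,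
      mul_one, mul_assoc, ← mul_assoc (frac b b), h₀, zero_mul, mul_zero]

theorem eq_zero_or_eq_frac (s : InverseHull M) : s = 0 ∨ ∃ a b, s = frac a b := by
  obtain ⟨f, hf⟩ := s
  induction hf with
  | leftMul a => exact Or.inr ⟨a, 1, (frac_one a).symm⟩
  | bot => exact Or.inl rfl
  | @symm f hf ih =>
    change star (R := InverseHull M) ⟨f, hf⟩ = 0 ∨
      ∃ a b, star (R := InverseHull M) ⟨f, hf⟩ = frac a b
    rcases ih with h | ⟨a, b, h⟩ <;> rw [h]
    · exact Or.inl (star_idem (mul_zero 0))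
    · exact Or.inr ⟨b, a, star_frac a b⟩
  | @trans f g hf hg ihf ihg =>
    change (⟨g, hg⟩ * ⟨f, hf⟩ : InverseHull M) = 0 ∨
      ∃ a b, (⟨g, hg⟩ * ⟨f, hf⟩ : InverseHull M) = frac a b
    rcases ihf with h | ⟨c, d, h⟩ <;> rcases ihg with h' | ⟨a, b, h'⟩ <;> rw [h, h']
    · exact Or.inl (mul_zero 0)
    · exact Or.inl (mul_zero _)
    · exact Or.inl (zero_mul _)
    · exact frac_mul_frac_eq_zero_or_eq_frac a b c d

theorem eq_frac_self_of_isIdempotentElem {e : InverseHull M} (he : IsIdempotentElem e)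
    (h₀ : e ≠ 0) : ∃ a, e = frac a a := by
  obtain ⟨a, b, rfl⟩ := (eq_zero_or_eq_frac e).resolve_left h₀
  obtain rfl := apply_eq_self_of_isIdempotentElem he (frac_apply_self a b)
  exact ⟨a, rfl⟩

end IsRightRigid

theorem ofMul_one_mem (F : TightFilter (InverseHull M)) : ofMul 1 ∈ F := by
  obtain ⟨e, he⟩ := F.nonempty
  exact F.mem_of_le e he _ isIdempotentElem_ofMul_one (mul_ofMul_one e)

end InverseHull

namespace WordMonoid

open SelfSimilarGroup InverseHull

variable {G X : Type*} [Group G] [MulAction G (List X)] [SelfSimilarGroup G X]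

theorem word_mul (a b : WordMonoid G X) : (a * b).word = a.word ++ a.elt • b.word := rfl

theorem elt_mul (a b : WordMonoid G X) : (a * b).elt = sec a.elt b.word * b.elt := rfl

theorem dvd_iff {a b : WordMonoid G X} : a ∣ b ↔ a.word <+: b.word := by
  constructor
  · rintro ⟨k, rfl⟩
    exact List.prefix_append _ _
  · rintro ⟨w, hw⟩
    refine ⟨⟨a.elt⁻¹ • w, (sec a.elt (a.elt⁻¹ • w))⁻¹ * b.elt⟩, WordMonoid.ext ?_ ?_⟩
    · rw [word_mul, smul_inv_smul, hw]
    · rw [elt_mul, mul_inv_cancel_left]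

instance : IsRightRigid (WordMonoid G X) where
  dvd_or_dvd a b m ha hb := by
    rw [dvd_iff] at ha hb ⊢
    rw [dvd_iff]
    exact List.prefix_or_prefix_of_prefix ha hb

variable (G) in
/-- A word over `X` as an element of the monoid `X* G`. -/
def ofWord (w : List X) : WordMonoid G X := ⟨w, 1⟩

theorem ofWord_append (u v : List X) : ofWord G (u ++ v) = ofWord G u * ofWord G v :=
  WordMonoid.ext (congrArg (u ++ ·) (one_smul G v).symm)
    (by rw [elt_mul, ofWord, ofWord, ofWord, mul_one, sec_one])

end WordMonoid

namespace SelfSimilarGroup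

open InverseHull WordMonoid InverseSemigroupWithZero

variable {G X : Type*} [Group G] [MulAction G (List X)] [SelfSimilarGroup G X]

variable (G) in
/-- The idempotent `w w*` of the inverse semigroup of `G`, the identity of `w X* G`. -/
noncomputable def cylinder (w : List X) : inverseSemigroup G X := frac (ofWord G w) (ofWord G w)

theorem isIdempotentElem_cylinder (w : List X) : IsIdempotentElem (cylinder G w) :=
  isIdempotentElem_frac_self _

theorem cylinder_ne_zero (w : List X) : cylinder G w ≠ 0 :=
  frac_ne_zero _ _

theorem cylinder_mul_eq_left_iff {u v : List X} :
    cylinder G u * cylinder G v = cylinder G u ↔ v <+: u :=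
  frac_self_mul_frac_self_eq_left_iff.trans dvd_iff

theorem cylinder_mul_cylinder_of_prefix {u v : List X} (h : u <+: v) :
    cylinder G u * cylinder G v = cylinder G v := by
  rw [idem_comm (isIdempotentElem_cylinder u) (isIdempotentElem_cylinder v),
    cylinder_mul_eq_left_iff.2 h]

theorem cylinder_mul_ne_zero_iff {u v : List X} :
    cylinder G u * cylinder G v ≠ 0 ↔ u <+: v ∨ v <+: u :=
  frac_self_mul_frac_self_ne_zero_iff_dvd_or_dvd.trans (or_congr dvd_iff dvd_iff)

theorem cylinder_injective : Function.Injective (cylinder G : List X → inverseSemigroup G X) := by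
  intro u v h
  have hvu : v <+: u := by
    rw [← cylinder_mul_eq_left_iff (G := G), ← h, isIdempotentElem_cylinder u]
  have huv : u <+: v := by
    rw [← cylinder_mul_eq_left_iff (G := G), h, isIdempotentElem_cylinder v]
  exact huv.eq_of_length_le hvu.length_le

theorem eq_cylinder_of_isIdempotentElem {e : inverseSemigroup G X} (he : IsIdempotentElem e)
    (h₀ : e ≠ 0) : ∃ w, e = cylinder G w := by
  obtain ⟨a, rfl⟩ := eq_frac_self_of_isIdempotentElem he h₀
  refine ⟨a.word, ext_some fun m m' => ?_⟩
  rw [cylinder, frac_self_apply_eq_some, frac_self_apply_eq_some, dvd_iff, dvd_iff, ofWord]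

theorem exists_eq_cylinder_of_mem {F : TightFilter (inverseSemigroup G X)}
    {e : inverseSemigroup G X} (he : e ∈ F) : ∃ w, e = cylinder G w :=
  eq_cylinder_of_isIdempotentElem (F.idem e he) fun h₀ => F.zero_notMem (h₀ ▸ he)

theorem exists_mul_cylinder_eq_cylinder_append {F : TightFilter (inverseSemigroup G X)}
    {e : inverseSemigroup G X} (he : e ∈ F) {u : List X} (hu : cylinder G u ∈ F) :
    ∃ y, e * cylinder G u = cylinder G (u ++ y) := by
  obtain ⟨w, hw⟩ := exists_eq_cylinder_of_mem (F.mul_mem _ he _ hu)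
  obtain ⟨y, rfl⟩ : u <+: w := by
    rw [← cylinder_mul_eq_left_iff (G := G), ← hw, mul_assoc, isIdempotentElem_cylinder]
  exact ⟨y, hw⟩

/-- The word `w` is strongly fixed by `g` (in the sense of Exel and Pardo): `g` fixes every word
that starts with `w`. -/
def StronglyFixes (g : G) (w : List X) : Prop := g • w = w ∧ sec g w = 1

section StronglyFixes

variable {g h : G} {u v w : List X}

theorem stronglyFixes_inv_mul_iff :
    StronglyFixes (h⁻¹ * g) w ↔ g • w = h • w ∧ sec g w = sec h w := by
  rw [StronglyFixes, mul_smul, inv_smul_eq_iff]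
  refine and_congr_right fun hw => ?_
  have hinv : sec h⁻¹ (h • w) * sec h w = 1 := by rw [← sec_mul, inv_mul_cancel, sec_one]
  rw [sec_mul, hw, eq_inv_of_mul_eq_one_left hinv, inv_mul_eq_one, eq_comm]

theorem stronglyFixes_inv_mul_append_iff :
    StronglyFixes (h⁻¹ * g) (u ++ v) ↔
      g • u = h • u ∧ StronglyFixes ((sec h u)⁻¹ * sec g u) v := by
  rw [stronglyFixes_inv_mul_iff, stronglyFixes_inv_mul_iff, smul_append, smul_append, sec_append,
    sec_append, ← and_assoc]
  refine and_congr_left fun _ => ⟨fun heq => ?_, fun heq => congrArg₂ _ heq.1 heq.2⟩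
  exact List.append_inj heq ((length_smul g u).trans (length_smul h u).symm)

theorem stronglyFixes_append_iff :
    StronglyFixes g (u ++ v) ↔ g • u = u ∧ StronglyFixes (sec g u) v := by
  have hone := stronglyFixes_inv_mul_append_iff (g := g) (h := 1) (u := u) (v := v)
  rwa [sec_one, inv_one, one_mul, one_mul, one_smul] at hone

theorem stronglyFixes_one (w : List X) : StronglyFixes (1 : G) w :=
  ⟨one_smul G w, sec_one w⟩

theorem StronglyFixes.append (hu : StronglyFixes g u) (v : List X) : StronglyFixes g (u ++ v) :=
  stronglyFixes_append_iff.2 ⟨hu.1, hu.2.symm ▸ stronglyFixes_one v⟩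

theorem StronglyFixes.of_prefix (hu : StronglyFixes g u) (huv : u <+: v) : StronglyFixes g v := by
  obtain ⟨y, rfl⟩ := huv
  exact hu.append y

theorem mul_ofWord_eq_iff {a c : WordMonoid G X} :
    a * ofWord G w = c * ofWord G w ↔
      a.word = c.word ∧ StronglyFixes (c.elt⁻¹ * a.elt) w := by
  rw [stronglyFixes_inv_mul_iff, WordMonoid.ext_iff, word_mul, word_mul, elt_mul, elt_mul,
    mul_left_inj, ← and_assoc]
  refine and_congr_left fun _ => ⟨fun h => ?_, fun h => congrArg₂ _ h.1 h.2⟩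
  exact List.append_inj' h ((length_smul _ _).trans (length_smul _ _).symm)

theorem mul_cylinder_append_eq_iff {s t : inverseSemigroup G X} {a c : WordMonoid G X}
    (hs : s.1 (ofWord G v) = some a) (ht : t.1 (ofWord G v) = some c) :
    s * cylinder G (v ++ w) = t * cylinder G (v ++ w) ↔
      a.word = c.word ∧ StronglyFixes (c.elt⁻¹ * a.elt) w := by
  rw [← mul_ofWord_eq_iff, cylinder, ofWord_append, mul_frac_self (apply_mul hs _),
    mul_frac_self (apply_mul ht _), frac_left_inj]

end StronglyFixes

/-- The minimal words strongly fixed by `g` have length at most `n`. -/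
def StrongFixDepthLE (X : Type*) [MulAction G (List X)] [SelfSimilarGroup G X] (g : G) (n : ℕ) :
    Prop :=
  ∀ ⦃w : List X⦄, StronglyFixes g w → StronglyFixes g (w.take n)

theorem StrongFixDepthLE.mono {g : G} {m n : ℕ} (hg : StrongFixDepthLE X g m) (hmn : m ≤ n) :
    StrongFixDepthLE X g n :=
  fun _ hw => (hg hw).of_prefix (List.take_prefix_take_left hmn)

theorem strongFixDepthLE_add_of_sec {g : G} {m n : ℕ}
    (hg : ∀ u : List X, u.length = m → StrongFixDepthLE X (sec g u) n) :
    StrongFixDepthLE X g (m + n) := by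
  intro w hw
  rcases le_total w.length m with hm | hm
  · rwa [List.take_of_length_le (hm.trans (Nat.le_add_right m n))]
  · rw [← List.take_append_drop m w, stronglyFixes_append_iff] at hw
    rw [List.take_add, stronglyFixes_append_iff]
    exact ⟨hw.1, hg _ (List.length_take_of_le hm) hw.2⟩

end SelfSimilarGroup

section InitialWord

variable {X : Type*}

/-- The word formed by the first `n` letters of an infinite word `ξ`. -/
def initialWord (ξ : ℕ → X) (n : ℕ) : List X := (List.range n).map ξ

theorem length_initialWord (ξ : ℕ → X) (n : ℕ) : (initialWord ξ n).length = n := by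
  rw [initialWord, List.length_map, List.length_range]

theorem take_initialWord (ξ : ℕ → X) {m n : ℕ} (h : m ≤ n) :
    (initialWord ξ n).take m = initialWord ξ m := by
  rw [initialWord, ← List.map_take, List.take_range, min_eq_left h, initialWord]

theorem initialWord_prefix (ξ : ℕ → X) {m n : ℕ} (h : m ≤ n) :
    initialWord ξ m <+: initialWord ξ n :=
  take_initialWord ξ h ▸ List.take_prefix m _

theorem initialWord_length_of_prefix {ξ : ℕ → X} {u : List X} {n : ℕ}
    (h : u <+: initialWord ξ n) : initialWord ξ u.length = u := by
  have hle : u.length ≤ n := length_initialWord ξ n ▸ h.length_le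
  rw [← take_initialWord ξ hle, ← List.prefix_iff_eq_take.1 h]

theorem exists_initialWord_eq [Nonempty X] (w : List X) :
    ∃ ξ : ℕ → X, initialWord ξ w.length = w := by
  refine ⟨fun i => w.getD i (Classical.arbitrary X),
    List.ext_getElem (length_initialWord _ _) fun i _ hi => ?_⟩
  simp only [initialWord, List.getElem_map, List.getElem_range, List.getD_eq_getElem _ _ hi]

theorem isLocallyConstant_initialWord [TopologicalSpace X] [DiscreteTopology X] (n : ℕ) :
    IsLocallyConstant fun ξ : ℕ → X => initialWord ξ n := by
  induction n with
  | zero => exact IsLocallyConstant.const []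
  | succ n ih =>
    have hlast : IsLocallyConstant fun ξ : ℕ → X => ξ n :=
      (IsLocallyConstant.of_discrete id).comp_continuous (continuous_apply n)
    simp only [initialWord, List.range_succ, List.map_append, List.map_singleton]
    exact ih.comp₂ hlast fun w x => w ++ [x]

end InitialWord

namespace SelfSimilarGroup

open InverseHull WordMonoid InverseSemigroupWithZero TightGroupoid Filter

variable {G X : Type*} [Group G] [MulAction G (List X)] [SelfSimilarGroup G X]

theorem eventually_eq_cylinder_of_mul_ne_zero (ξ : ℕ → X) {e : inverseSemigroup G X}
    (he : IsIdempotentElem e) :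
    ∀ᶠ m in atTop, cylinder G (initialWord ξ m) * e ≠ 0 →
      ∃ n, cylinder G (initialWord ξ n) = e := by
  by_cases h₀ : e = 0
  · exact Eventually.of_forall fun m hm => (hm (by rw [h₀, mul_zero])).elim
  · obtain ⟨u, rfl⟩ := eq_cylinder_of_isIdempotentElem he h₀
    filter_upwards [eventually_ge_atTop u.length] with m hm hne
    have hu : u <+: initialWord ξ m := by
      rcases cylinder_mul_ne_zero_iff.1 hne with h | h
      · rw [h.eq_of_length_le (hm.trans_eq (length_initialWord ξ m).symm)]
      · exact h
    exact ⟨u.length, congrArg _ (initialWord_length_of_prefix hu)⟩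

variable (G) in
/-- The tight filter of an infinite word: the idempotents `w w*` of its finite prefixes `w`. -/
noncomputable def pathFilter (ξ : ℕ → X) : TightFilter (inverseSemigroup G X) where
  carrier := Set.range fun n => cylinder G (initialWord ξ n)
  idem := by
    rintro _ ⟨n, rfl⟩
    exact isIdempotentElem_cylinder _
  nonempty := Set.range_nonempty _
  zero_notMem := fun ⟨n, hn⟩ => cylinder_ne_zero _ hn
  mul_mem := by
    rintro _ ⟨m, rfl⟩ _ ⟨n, rfl⟩
    rcases le_total m n with h | h
    · exact ⟨n, (cylinder_mul_cylinder_of_prefix (initialWord_prefix ξ h)).symm⟩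
    · exact ⟨m, (cylinder_mul_eq_left_iff.2 (initialWord_prefix ξ h)).symm⟩
  mem_of_le := by
    rintro _ ⟨n, rfl⟩ e he hle
    have h₀ : cylinder G (initialWord ξ n) * e ≠ 0 := hle.symm ▸ cylinder_ne_zero _
    obtain ⟨u, rfl⟩ := eq_cylinder_of_isIdempotentElem he (right_ne_zero_of_mul h₀)
    exact ⟨u.length, congrArg _ (initialWord_length_of_prefix (cylinder_mul_eq_left_iff.1 hle))⟩
  tight := by
    rintro _ ⟨n, rfl⟩ C ⟨hC, hcover⟩
    obtain ⟨m, hmn, hm⟩ := ((eventually_ge_atTop n).and <| (eventually_all_finset C).2 fun c hc =>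
      eventually_eq_cylinder_of_mul_ne_zero ξ (hC c hc).1).exists
    obtain ⟨c, hc, hne⟩ := hcover _ (isIdempotentElem_cylinder _) (cylinder_ne_zero _)
      (cylinder_mul_eq_left_iff.2 (initialWord_prefix ξ hmn))
    exact ⟨c, hc, hm c hc hne⟩

theorem cylinder_mem_pathFilter {ξ : ℕ → X} {u : List X} :
    cylinder G u ∈ pathFilter G ξ ↔ initialWord ξ u.length = u := by
  refine ⟨fun ⟨n, hn⟩ => ?_, fun h => ⟨u.length, congrArg _ h⟩⟩
  rw [← cylinder_injective hn, length_initialWord]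

section Topology

variable [TopologicalSpace X] [DiscreteTopology X]

theorem isClopen_setOf_mem_pathFilter (e : inverseSemigroup G X) :
    IsClopen {ξ : ℕ → X | e ∈ pathFilter G ξ} := by
  by_cases he : ∃ u, e = cylinder G u
  · obtain ⟨u, rfl⟩ := he
    simp only [cylinder_mem_pathFilter]
    exact (isLocallyConstant_initialWord u.length).isClopen_fiber u
  · convert isClopen_empty
    exact Set.eq_empty_of_forall_notMem fun ξ hξ =>
      he (exists_eq_cylinder_of_mem (F := pathFilter G ξ) hξ)

theorem continuous_pathFilter : Continuous fun ξ : ℕ → X => pathFilter G ξ := by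
  refine continuous_generateFrom_iff.2 ?_
  rintro _ ⟨e, -, rfl | rfl⟩
  · exact (isClopen_setOf_mem_pathFilter e).isOpen
  · exact (isClopen_setOf_mem_pathFilter e).compl.isOpen

end Topology

theorem ofMul_mul_cylinder_eq_iff {g : G} {w : List X} :
    ofMul ⟨[], g⟩ * cylinder G w = ofMul 1 * cylinder G w ↔ StronglyFixes g w := by
  have h := mul_cylinder_append_eq_iff (v := []) (w := w)
    (ofMul_apply_eq_some.2 (mul_one (⟨[], g⟩ : WordMonoid G X)))
    (ofMul_apply_eq_some.2 (mul_one (1 : WordMonoid G X)))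
  refine h.trans ((and_iff_right rfl).trans ?_)
  rw [show (1 : WordMonoid G X).elt = 1 from rfl, inv_one, one_mul]

theorem pathFilter_mem_eqLocus_iff {g : G} {ξ : ℕ → X} :
    pathFilter G ξ ∈ eqLocus (ofMul ⟨[], g⟩) (ofMul 1) ↔
      ∃ n, StronglyFixes g (initialWord ξ n) := by
  rw [eqLocus, Set.mem_ofPred_eq, star_ofMul_mul_ofMul, star_ofMul_mul_ofMul,
    and_iff_right (ofMul_one_mem _), and_iff_right (ofMul_one_mem _)]
  exact Set.exists_range_iff.trans (exists_congr fun n => ofMul_mul_cylinder_eq_iff)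

theorem exists_cylinder_mem_of_dom {s t : inverseSemigroup G X}
    {F : TightFilter (inverseSemigroup G X)} (hs : star s * s ∈ F) (ht : star t * t ∈ F) :
    ∃ v a c, cylinder G v ∈ F ∧ s.1 (ofWord G v) = some a ∧ t.1 (ofWord G v) = some c := by
  have hst := F.mul_mem _ hs _ ht
  obtain ⟨v, hv⟩ := exists_eq_cylinder_of_mem hst
  obtain ⟨m, htm, hsm⟩ := mul_apply_eq_some.1 <|
    (congrArg (fun r => r.1 (ofWord G v)) hv).trans (frac_apply_self (ofWord G v) (ofWord G v))
  obtain rfl := apply_eq_self_of_isIdempotentElem (idem_star_mul t) htm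
  obtain ⟨a, ha, -⟩ := mul_apply_eq_some.1 hsm
  obtain ⟨c, hc, -⟩ := mul_apply_eq_some.1 htm
  exact ⟨v, a, c, hv ▸ hst, ha, hc⟩

section Finite

variable [Finite X] [Nonempty X]

theorem exists_strongFixDepthLE_of_isClosed {g : G}
    (hg : IsClosed (eqLocus (ofMul (⟨[], g⟩ : WordMonoid G X)) (ofMul 1))) :
    ∃ n, StrongFixDepthLE X g n := by
  let _ : TopologicalSpace X := ⊥
  have _ : DiscreteTopology X := ⟨rfl⟩
  have hclosed : IsClosed {ξ : ℕ → X | ∃ n, StronglyFixes g (initialWord ξ n)} := by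
    simp only [← pathFilter_mem_eqLocus_iff]
    exact hg.preimage continuous_pathFilter
  have hmono : Monotone fun n => {ξ : ℕ → X | StronglyFixes g (initialWord ξ n)} :=
    fun m n hmn ξ hξ => StronglyFixes.of_prefix hξ (initialWord_prefix ξ hmn)
  obtain ⟨n, hn⟩ := hclosed.isCompact.elim_directed_cover _
    (fun n => (isLocallyConstant_initialWord n) {w | StronglyFixes g w})
    (fun ξ hξ => Set.mem_iUnion.2 hξ) hmono.directed_le
  refine ⟨n, fun w hw => ?_⟩
  rcases le_total w.length n with hwn | hnw
  · rwa [List.take_of_length_le hwn]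
  · obtain ⟨ξ, hξ⟩ := exists_initialWord_eq w
    rw [← hξ, take_initialWord ξ hnw]
    exact hn ⟨w.length, hξ.symm ▸ hw⟩

theorem covers_image_cylinder_append (v : List X) (n : ℕ) :
    Covers ((List.finite_length_eq X n).image fun z => cylinder G (v ++ z)).toFinset
      (cylinder G v) := by
  refine ⟨fun c hc => ?_, fun f hf hf₀ hfv => ?_⟩
  · obtain ⟨z, -, rfl⟩ := (Set.Finite.mem_toFinset _).1 hc
    exact ⟨isIdempotentElem_cylinder _, cylinder_mul_eq_left_iff.2 (List.prefix_append v z)⟩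
  · obtain ⟨_, rfl⟩ := eq_cylinder_of_isIdempotentElem hf hf₀
    obtain ⟨y, rfl⟩ := cylinder_mul_eq_left_iff.1 hfv
    let x : List X := List.replicate n (Classical.arbitrary X)
    have hlen : n ≤ (y ++ x).length := by
      rw [List.length_append, List.length_replicate]
      exact Nat.le_add_left n _
    refine ⟨_, (Set.Finite.mem_toFinset _).2
      ⟨(y ++ x).take n, List.length_take_of_le hlen, rfl⟩, ?_⟩
    rw [cylinder_mul_ne_zero_iff, List.prefix_append_right_inj, List.prefix_append_right_inj]
    exact List.prefix_or_prefix_of_prefix (List.prefix_append y x) (List.take_prefix n _)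

theorem exists_cylinder_append_mem {F : TightFilter (inverseSemigroup G X)} {v : List X}
    (hv : cylinder G v ∈ F) (n : ℕ) : ∃ z : List X, z.length = n ∧ cylinder G (v ++ z) ∈ F := by
  obtain ⟨c, hc, hcF⟩ := F.tight _ hv _ (covers_image_cylinder_append v n)
  obtain ⟨z, hz, rfl⟩ := (Set.Finite.mem_toFinset _).1 hc
  exact ⟨z, hz, hcF⟩

theorem isClosed_eqLocus_of_forall_exists_strongFixDepthLE
    (H : ∀ g : G, ∃ n, StrongFixDepthLE X g n) (s t : inverseSemigroup G X) :
    IsClosed (eqLocus s t) := by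
  refine isClosed_of_closure_subset fun F hF => ?_
  have hs : star s * s ∈ F := closure_minimal (fun F' h => h.1)
    (TightFilter.isClopen_setOf_mem (idem_star_mul s)).isClosed hF
  have ht : star t * t ∈ F := closure_minimal (fun F' h => h.2.1)
    (TightFilter.isClopen_setOf_mem (idem_star_mul t)).isClosed hF
  obtain ⟨v, a, c, hvF, ha, hc⟩ := exists_cylinder_mem_of_dom hs ht
  obtain ⟨n, hn⟩ := H (c.elt⁻¹ * a.elt)
  obtain ⟨z, rfl, hzF⟩ := exists_cylinder_append_mem hvF n
  obtain ⟨F', hzF', -, -, e, he, hst⟩ :=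
    mem_closure_iff.1 hF _ (TightFilter.isOpen_setOf_mem (cylinder G (v ++ z))) hzF
  obtain ⟨y, hy⟩ := exists_mul_cylinder_eq_cylinder_append he hzF'
  have hzy : s * cylinder G (v ++ (z ++ y)) = t * cylinder G (v ++ (z ++ y)) := by
    rw [← List.append_assoc, ← hy, ← mul_assoc, hst, mul_assoc]
  obtain ⟨hword, hfix⟩ := (mul_cylinder_append_eq_iff ha hc).1 hzy
  have hz := hn hfix
  rw [List.take_left] at hz
  exact ⟨hs, ht, _, hzF, (mul_cylinder_append_eq_iff ha hc).2 ⟨hword, hz⟩⟩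

theorem t2Space_iff_forall_exists_strongFixDepthLE :
    T2Space (TightGroupoid (inverseSemigroup G X)) ↔ ∀ g : G, ∃ n, StrongFixDepthLE X g n := by
  rw [t2Space_iff_isClosed_eqLocus]
  exact ⟨fun H g => exists_strongFixDepthLE_of_isClosed (H _ _),
    isClosed_eqLocus_of_forall_exists_strongFixDepthLE⟩

end Finite

end SelfSimilarGroup

namespace FiniteAutomaton

open SelfSimilarGroup

variable {G X : Type*} [Group G] [MulAction G (List X)] [SelfSimilarGroup G X]
  (A : FiniteAutomaton G X)

theorem wordRel_iff {w : List X} {g h : A.carrier} :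
    A.wordRel w g h ↔ StronglyFixes (h.1⁻¹ * g.1) w := by
  induction w generalizing g h with
  | nil =>
    rw [stronglyFixes_inv_mul_iff, smul_nil, smul_nil, and_iff_right rfl]
    exact Subtype.ext_iff
  | cons x w ih =>
    rw [← List.singleton_append, stronglyFixes_inv_mul_append_iff]
    exact and_congr_right' ih

theorem ncard_reachSet_eq_one_iff {w : List X} :
    (A.reachSet w).ncard = 1 ↔ ∀ v, A.vertex (w ++ v) = A.vertex w := by
  have hw : A.vertex w ∈ A.reachSet w := ⟨[], by rw [List.append_nil]⟩
  rw [Set.ncard_eq_one]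
  constructor
  · rintro ⟨r, hr⟩ v
    rw [hr, Set.mem_singleton_iff] at hw
    exact (hr.subset ⟨v, rfl⟩ : A.vertex (w ++ v) = r).trans hw.symm
  · refine fun h => ⟨A.vertex w, Set.eq_singleton_iff_unique_mem.2 ⟨hw, ?_⟩⟩
    rintro _ ⟨v, rfl⟩
    exact h v

theorem forall_ncard_reachSet_eq_one_iff {n : ℕ} :
    (∀ w : List X, w.length = n → (A.reachSet w).ncard = 1) ↔
      ∀ w, A.vertex w = A.vertex (w.take n) := by
  simp only [ncard_reachSet_eq_one_iff]
  constructor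
  · intro h w
    rcases le_total w.length n with hw | hw
    · rw [List.take_of_length_le hw]
    · conv_lhs => rw [← List.take_append_drop n w]
      exact h _ (List.length_take_of_le hw) _
  · rintro h w rfl v
    rw [h (w ++ v), List.take_left]

theorem forall_vertex_eq_vertex_take_iff {n : ℕ} :
    (∀ w, A.vertex w = A.vertex (w.take n)) ↔
      ∀ g ∈ A.carrier, ∀ h ∈ A.carrier, StrongFixDepthLE X (h⁻¹ * g) n := by
  constructor
  · intro H g hg h hh w hw
    have hrel : A.wordRel w = A.wordRel (w.take n) := congrArg Subtype.val (H w)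
    exact (A.wordRel_iff (g := ⟨g, hg⟩) (h := ⟨h, hh⟩)).1 (hrel ▸ A.wordRel_iff.2 hw)
  · refine fun H w => Subtype.ext (Setoid.ext fun g h => ?_)
    change A.wordRel w g h ↔ A.wordRel (w.take n) g h
    rw [wordRel_iff, wordRel_iff]
    exact ⟨fun hw => H _ g.2 _ h.2 hw, fun hw => hw.of_prefix (List.take_prefix n w)⟩

theorem exists_eq_vertex (v : A.Vertex) : ∃ w, v = A.vertex w :=
  v.2.imp fun _ h => Subtype.ext h

theorem reflTransGen_edge_vertex_append (u w : List X) :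
    Relation.ReflTransGen A.Edge (A.vertex w) (A.vertex (u ++ w)) := by
  induction u with
  | nil => exact .refl
  | cons x u ih => exact ih.tail ⟨x, rfl⟩

theorem minimalVertices_subset_essentialVertices [Nonempty X] :
    A.minimalVertices ⊆ A.essentialVertices := by
  intro v hv
  obtain ⟨w, rfl⟩ := A.exists_eq_vertex v
  have hedge : A.Edge (A.vertex w) (A.vertex (Classical.arbitrary X :: w)) := ⟨_, rfl⟩
  exact ⟨A.vertex w, .head' hedge (hv _ (.single hedge)), .refl⟩

variable {A}

theorem exists_eq_vertex_append_of_reflTransGen {w : List X} {v : A.Vertex}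
    (h : Relation.ReflTransGen A.Edge (A.vertex w) v) : ∃ u, v = A.vertex (u ++ w) := by
  induction h with
  | refl => exact ⟨[], rfl⟩
  | tail _ hedge ih =>
    obtain ⟨u, rfl⟩ := ih
    obtain ⟨x, hx⟩ := hedge
    exact ⟨x :: u, Subtype.ext hx⟩

theorem exists_eq_vertex_cons_append_of_transGen {w : List X} {v : A.Vertex}
    (h : Relation.TransGen A.Edge (A.vertex w) v) : ∃ x u, v = A.vertex (x :: (u ++ w)) := by
  obtain ⟨v', hv', x, hx⟩ := Relation.TransGen.tail'_iff.1 h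
  obtain ⟨u, rfl⟩ := exists_eq_vertex_append_of_reflTransGen hv'
  exact ⟨x, u, Subtype.ext hx⟩

theorem exists_eq_vertex_of_mem_essentialVertices {v : A.Vertex} (hv : v ∈ A.essentialVertices)
    (n : ℕ) : ∃ w, n ≤ w.length ∧ v = A.vertex w := by
  obtain ⟨c, hcycle, hcv⟩ := hv
  obtain ⟨w, hw, rfl⟩ : ∃ w, n ≤ w.length ∧ c = A.vertex w := by
    induction n with
    | zero => exact (A.exists_eq_vertex c).imp fun w hw => ⟨Nat.zero_le _, hw⟩
    | succ n ih =>
      obtain ⟨w, hw, rfl⟩ := ih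
      obtain ⟨x, u, hc⟩ := exists_eq_vertex_cons_append_of_transGen hcycle
      refine ⟨_, ?_, hc⟩
      rw [List.length_cons, List.length_append]
      omega
  obtain ⟨u, rfl⟩ := exists_eq_vertex_append_of_reflTransGen hcv
  exact ⟨u ++ w, hw.trans (List.suffix_append u w).length_le, rfl⟩

theorem essentialVertices_subset_minimalVertices {n : ℕ}
    (hn : ∀ w, A.vertex w = A.vertex (w.take n)) :
    A.essentialVertices ⊆ A.minimalVertices := by
  intro v hv v' hvv'
  obtain ⟨w, hw, rfl⟩ := exists_eq_vertex_of_mem_essentialVertices hv n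
  obtain ⟨u, rfl⟩ := exists_eq_vertex_append_of_reflTransGen hvv'
  have hreturn : A.vertex (w ++ (u ++ w)) = A.vertex w := by
    rw [hn, List.take_append_of_le_length hw, ← hn]
  exact hreturn ▸ A.reflTransGen_edge_vertex_append w (u ++ w)

theorem absorbing_of_nucleus_subset (hG : IsContracting G X) (hA : nucleus G X ⊆ A.carrier) :
    A.Absorbing := by
  obtain ⟨N, hN, hNuc⟩ := (nucleus_isLeast hG).1
  exact fun g => (hN g).imp fun n hn w hw => hA (hNuc ▸ hn w hw)

theorem Absorbing.one_mem [Nonempty X] (hA : A.Absorbing) : 1 ∈ A.carrier := by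
  obtain ⟨n, hn⟩ := hA 1
  exact sec_one (G := G) (List.replicate n (Classical.arbitrary X)) ▸ hn _ List.length_replicate

theorem Absorbing.forall_exists_strongFixDepthLE_iff [Nonempty X] (hA : A.Absorbing) :
    (∀ g : G, ∃ n, StrongFixDepthLE X g n) ↔
      ∃ n, ∀ w, A.vertex w = A.vertex (w.take n) := by
  rw [exists_congr fun n => A.forall_vertex_eq_vertex_take_iff]
  constructor
  · intro H
    refine ((Filter.eventually_all_finite A.finite).2 fun g _ =>
      (Filter.eventually_all_finite A.finite).2 fun h _ => ?_).exists (f := Filter.atTop)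
    obtain ⟨n, hn⟩ := H (h⁻¹ * g)
    exact (Filter.eventually_ge_atTop n).mono fun m hm => hn.mono hm
  · rintro ⟨n, hn⟩ g
    obtain ⟨m, hm⟩ := hA g
    refine ⟨m + n, strongFixDepthLE_add_of_sec fun u hu => ?_⟩
    have hdepth := hn _ (hm u hu) 1 hA.one_mem
    rwa [inv_one, one_mul] at hdepth

end FiniteAutomaton

theorem propositionp {G X : Type*} [Group G] [Finite X] [Nontrivial X] [MulAction G (List X)]
    [SelfSimilarGroup G X] (hG : IsContracting G X) (A : FiniteAutomaton G X)
    (hA : nucleus G X ⊆ A.carrier) :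
    (T2Space (TightGroupoid (SelfSimilarGroup.inverseSemigroup G X)) ↔
      ∃ n : ℕ, ∀ w : List X, w.length = n → (A.reachSet w).ncard = 1) ∧
    (T2Space (TightGroupoid (SelfSimilarGroup.inverseSemigroup G X)) →
      A.minimalVertices = A.essentialVertices) := by
  have hAbs : A.Absorbing := FiniteAutomaton.absorbing_of_nucleus_subset hG hA
  rw [SelfSimilarGroup.t2Space_iff_forall_exists_strongFixDepthLE,
    hAbs.forall_exists_strongFixDepthLE_iff,
    exists_congr fun n => A.forall_ncard_reachSet_eq_one_iff (n := n)]
  refine ⟨Iff.rfl, fun ⟨n, hn⟩ => ?_⟩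
  exact A.minimalVertices_subset_essentialVertices.antisymm
    (FiniteAutomaton.essentialVertices_subset_minimalVertices hn)
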